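/- **Setting.** Put $w(k)=-i(k^4-k^2)$ and $D^+=\{k\in\mathbb C:\operatorname{Re}w(k)<0,\ \operatorname{Im}k>0\}$. The boundary $\partial D^+$, oriented so that $D^+$ lies to its left, consists of the paths $$\gamma_1(s)=is\ (\infty>s\ge0),\qquad \gamma_2(s)=s\ (0<s<\tfrac1{\sqrt2}),\qquad \gamma_3(s)=s+i\sqrt{s^2-\tfrac12}\ (s\ge\tfrac1{\sqrt2}),$$ $$\gamma_4(s)=-s+i\sqrt{s^2-\tfrac12}\ (s\ge\tfrac1{\sqrt2}),\qquad \gamma_5(s)=s\ (s\le-\tfrac1{\sqrt2}),$$ where $\gamma_1$ is run through from $i\infty$ to $0$ and the other paths in the direction of increasing $s$. Let $\nu(k)=|1-k^2|^{1/2}e^{i\theta/2}$, where $\theta$ is the argument of $1-k^2$ that is chosen by one of the following two rules: - (a) $\theta\in[\epsilon,2\pi+\epsilon)$ for some fixed $\epsilon\in(0,\pi/2)$; - (b) $\theta\in(0,2\pi]$ if $\operatorname{Re}k\ge0$ and $\theta\in[0,2\pi)$ if $\operatorname{Re}k<0$ (on $\overline{D^+}$ this is the square root of $1-k^2$ that is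 continuous, analytic in $D^+$, and has $\operatorname{Im}\nu\ge0$). Let $T>0$, and let $g_0,g_1\in L^1(\mathbb R;\mathbb C)$ have compact support in $(0,T)$. Put $\tilde g_j(k,t)=\int_0^te^{ks}g_j(s)\,ds$ and $$E(k;x,t)=-\frac1{2\pi}e^{ikx-w(k)t},$$ $$G(k;t)=-2ik(k+\nu(k))\,\tilde g_1(w(k),t)-2k\,\nu(k)(k+\nu(k))\,\tilde g_0(w(k),t),$$ $$W_b[g_0,g_1](x,t)=\int_{\partial D^+}E(k;x,t)\,G(k;T)\,dk .$$ Let $\Psi_i(y)=\frac1{2\pi}\int_{\mathbb R}e^{isy}\hat\Psi_i(s)\,ds$, $i=1,\dots,5$, where - $\hat\Psi_1(s)=G(is;T)$ for $s\ge0$, - $\hat\Psi_2(s)=G(s;T)$ for $0\le s\le\frac1{\sqrt2}$, - $\hat\Psi_3(s)=G\big(s+i\sqrt{s^2-\tfrac12};T\big)\Big(1+\frac{is}{\sqrt{s^2-1/2}}\Big)$ for $s\ge\frac1{\sqrt2}$, - $\hat\Psi_4(s)=G\big(-s+i\sqrt{s^2-\tfrac12};T\big)\Big(-1+\frac{is}{\sqrt{s^2-1/2}}\Big)$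 for $s\ge\frac1{\sqrt2}$, - $\hat\Psi_5(s)=G(s;T)$ for $s\le-\frac1{\sqrt2}$, and $\hat\Psi_i(s)=0$ for all other $s$. **Theorem (dispersion estimates).** There is an absolute constant $C$ (independent of $\nu$, $T$, $g_0$, $g_1$, $r$ and $t$) such that the following holds. If $G(\cdot;T)$ is absolutely integrable along $\partial D^+$, which is always the case if $g_0,g_1\in C^2$, then for all $r\in[2,\infty]$, with $\frac1r+\frac1{r'}=1$, and all $0<t\le1$, the function $x\mapsto W_b[g_0,g_1](x,t)$ is measurable on $\mathbb R_+=(0,\infty)$ and $$\|W_b[g_0,g_1](\cdot,t)\|_{L^r(\mathbb R_+)}\le C\,t^{-\left(\frac14-\frac1{2r}\right)}\sum_{i=1}^5\|\Psi_i\|_{L^{r'}(\mathbb R)}$$ (the right-hand side may be $+\infty$). -/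

import Mathlib

open MeasureTheory Set
open scoped NNReal ENNReal

noncomputable section

namespace HalfLine4NLS

/-- The spectral input `w(k) = -i (k⁴ - k²)` of the operator `P = -i(∂ₓ⁴ + ∂ₓ²)`. -/
def w (k : ℂ) : ℂ := -Complex.I * (k ^ 4 - k ^ 2)

/-- The region `D⁺ = {k : Re w(k) < 0, Im k > 0}`. -/
def Dplus : Set ℂ := {k | (w k).re < 0 ∧ 0 < k.im}

/-- The five paths that make up `∂D⁺`. -/
def path : Fin 5 → ℝ → ℂ
  | 0 => fun s => Complex.I * s
  | 1 => fun s => s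
  | 2 => fun s => s + Complex.I * (Real.sqrt (s ^ 2 - 1 / 2) : ℝ)
  | 3 => fun s => -s + Complex.I * (Real.sqrt (s ^ 2 - 1 / 2) : ℝ)
  | 4 => fun s => s

/-- The parameter interval of each path. -/
def param : Fin 5 → Set ℝ
  | 0 => Ici 0
  | 1 => Ioo 0 (1 / Real.sqrt 2)
  | 2 => Ici (1 / Real.sqrt 2)
  | 3 => Ici (1 / Real.sqrt 2)
  | 4 => Iic (-(1 / Real.sqrt 2))

/-- The derivative of each path in its parameter. -/
def velocity : Fin 5 → ℝ → ℂ
  | 0 => fun _ => Complex.I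
  | 1 => fun _ => 1
  | 2 => fun s => 1 + Complex.I * s / (Real.sqrt (s ^ 2 - 1 / 2) : ℝ)
  | 3 => fun s => -1 + Complex.I * s / (Real.sqrt (s ^ 2 - 1 / 2) : ℝ)
  | 4 => fun _ => 1

/-- The orientation of each path for which `D⁺` stays on the left: the half line
`path 0` is run through from `i∞` down to `0`, the other paths in the direction of
increasing parameter. -/
def orientation : Fin 5 → ℂ
  | 0 => -1
  | _ => 1

/-- The oriented contour integral `∫_{∂D⁺} f(k) dk`. -/
def boundaryIntegral (f : ℂ → ℂ) : ℂ :=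
  ∑ i : Fin 5, orientation i * ∫ s in param i, f (path i s) * velocity i s

/-- The time transform `g̃(k,t) = ∫₀ᵗ e^{ks} g(s) ds`. -/
def timeTransform (g : ℝ → ℂ) (k : ℂ) (t : ℝ) : ℂ :=
  ∫ s in (0 : ℝ)..t, Complex.exp (k * s) * g s

/-- `|z|^{1/2} e^{iθ/2}`, the square root of `z` built from an argument `θ` of `z`. -/
def sqrtWithArg (z : ℂ) (θ : ℝ) : ℂ :=
  (Real.sqrt ‖z‖ : ℝ) * Complex.exp (Complex.I * θ / 2)

/-- `√(1 - k²)` with the argument of `1 - k²` taken in `[ε, 2π + ε)`. -/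
def nuStar (ε : ℝ) (k : ℂ) : ℂ :=
  sqrtWithArg (1 - k ^ 2) (toIcoMod Real.two_pi_pos ε (Complex.arg (1 - k ^ 2)))

/-- `√(1 - k²)` with the argument of `1 - k²` taken in `(0, 2π]` for `Re k ≥ 0` and in `[0, 2π)`
for `Re k < 0`. On the closure of `D⁺` this is the one square root of `1 - k²` that is continuous,
has nonnegative imaginary part there, and is analytic on `D⁺`. -/
def nuClosed (k : ℂ) : ℂ :=
  if 0 ≤ k.re then
    sqrtWithArg (1 - k ^ 2) (toIocMod Real.two_pi_pos 0 (Complex.arg (1 - k ^ 2)))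
  else
    sqrtWithArg (1 - k ^ 2) (toIcoMod Real.two_pi_pos 0 (Complex.arg (1 - k ^ 2)))

/-- The branches of `√(1 - k²)` that are considered: the square roots with slightly rotated
branch cut, and the one that is continuous up to the boundary of `D⁺`. -/
def branches : Set (ℂ → ℂ) :=
  {ν | ∃ ε : ℝ, 0 < ε ∧ ε < Real.pi / 2 ∧ ν = nuStar ε} ∪ {nuClosed}

/-- `E(k;x,t) = -(1/2π) e^{ikx - w(k)t}`. -/
def E (k : ℂ) (x t : ℝ) : ℂ :=
  -(1 / (2 * Real.pi)) * Complex.exp (Complex.I * k * x - w k * t)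

/-- `G(k;t) = -2ik(k + ν(k)) g̃₁(w(k),t) - 2kν(k)(k + ν(k)) g̃₀(w(k),t)`. -/
def G (ν : ℂ → ℂ) (g₀ g₁ : ℝ → ℂ) (k : ℂ) (t : ℝ) : ℂ :=
  -2 * Complex.I * k * (k + ν k) * timeTransform g₁ (w k) t
    - 2 * k * ν k * (k + ν k) * timeTransform g₀ (w k) t

/-- The boundary integral operator `W_b[g₀,g₁](x,t) = ∫_{∂D⁺} E(k;x,t) G(k;T) dk`. -/
def Wb (ν : ℂ → ℂ) (T : ℝ) (g₀ g₁ : ℝ → ℂ) (x t : ℝ) : ℂ :=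
  boundaryIntegral fun k => E k x t * G ν g₀ g₁ k T

/-- `Ψ̂ᵢ`: the restrictions of `G(·;T)` to the five pieces of `∂D⁺`, with the Jacobian of the
parametrization on the two hyperbolic arcs, extended by zero to the real line. -/
def PsiHat (ν : ℂ → ℂ) (T : ℝ) (g₀ g₁ : ℝ → ℂ) : Fin 5 → ℝ → ℂ
  | 0 => (Ici (0 : ℝ)).indicator fun s => G ν g₀ g₁ (Complex.I * s) T
  | 1 => (Icc (0 : ℝ) (1 / Real.sqrt 2)).indicator fun s => G ν g₀ g₁ s T
  | 2 => (Ici (1 / Real.sqrt 2)).indicator fun s =>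
      G ν g₀ g₁ (s + Complex.I * (Real.sqrt (s ^ 2 - 1 / 2) : ℝ)) T
        * (1 + Complex.I * s / (Real.sqrt (s ^ 2 - 1 / 2) : ℝ))
  | 3 => (Ici (1 / Real.sqrt 2)).indicator fun s =>
      G ν g₀ g₁ (-s + Complex.I * (Real.sqrt (s ^ 2 - 1 / 2) : ℝ)) T
        * (-1 + Complex.I * s / (Real.sqrt (s ^ 2 - 1 / 2) : ℝ))
  | 4 => (Iic (-(1 / Real.sqrt 2))).indicator fun s => G ν g₀ g₁ s T

/-- The inverse Fourier transform `(1/2π) ∫ e^{isy} f(s) ds`. -/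
def invFourier (f : ℝ → ℂ) (y : ℝ) : ℂ :=
  1 / (2 * Real.pi) * ∫ s : ℝ, Complex.exp (Complex.I * s * y) * f s

/-- `Ψᵢ`, the inverse Fourier transform of `Ψ̂ᵢ`. -/
def Psi (ν : ℂ → ℂ) (T : ℝ) (g₀ g₁ : ℝ → ℂ) (i : Fin 5) : ℝ → ℂ :=
  invFourier (PsiHat ν T g₀ g₁ i)

/-- `G(·;T)` is absolutely integrable along `∂D⁺`. -/
def AbsIntegrableAlongBoundary (ν : ℂ → ℂ) (T : ℝ) (g₀ g₁ : ℝ → ℂ) : Prop :=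
  ∀ i : Fin 5, IntegrableOn (fun s => G ν g₀ g₁ (path i s) T * velocity i s) (param i)

lemma w_re (k : ℂ) : (w k).re = 2 * k.im * (k.re * (2 * k.re ^ 2 - 2 * k.im ^ 2 - 1)) := by
  simp [w, pow_succ]
  ring

lemma isOpen_Dplus : IsOpen Dplus := by
  have h : Continuous fun k => (w k).re := by unfold w; fun_prop
  exact (isOpen_lt h continuous_const).inter (isOpen_lt continuous_const Complex.continuous_im)

lemma mem_closure_Dplus {p v : ℂ} (h : ∀ δ : ℝ, 0 < δ → p + δ * v ∈ Dplus) :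
    p ∈ closure Dplus := by
  have h1 : Filter.Tendsto (fun δ : ℝ => p + δ * v) (nhdsWithin 0 (Ioi 0)) (nhds p) := by
    have : Continuous fun δ : ℝ => p + δ * v := by fun_prop
    have h2 := this.tendsto 0
    simp only [Complex.ofReal_zero, zero_mul, add_zero] at h2
    exact h2.mono_left nhdsWithin_le_nhds
  exact mem_closure_of_tendsto h1 (by filter_upwards [self_mem_nhdsWithin] with δ hδ using h δ hδ)

lemma mem_Dplus {k : ℂ} (hb : 0 < k.im) (h : k.re * (2 * k.re ^ 2 - 2 * k.im ^ 2 - 1) < 0) :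
    k ∈ Dplus := by
  refine ⟨?_, hb⟩
  rw [w_re]
  exact mul_neg_of_pos_of_neg (by positivity) h

/-- The five paths together trace out exactly the boundary of `D⁺`. -/
lemma iUnion_path_eq_frontier : ⋃ i, path i '' param i = frontier Dplus := by
  have hc : 0 < 1 / Real.sqrt 2 := by positivity
  have hc2 : (1 / Real.sqrt 2) ^ 2 = 1 / 2 := by
    rw [div_pow, Real.sq_sqrt (by norm_num)]; norm_num
  generalize hcc : 1 / Real.sqrt 2 = c at hc hc2
  rw [isOpen_Dplus.frontier_eq]
  ext p
  simp only [mem_iUnion, mem_image, mem_sdiff]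
  constructor
  · rintro ⟨i, s, hs, rfl⟩
    fin_cases i
    · have hs : 0 ≤ s := hs
      refine ⟨mem_closure_Dplus (v := 1 + Complex.I) fun δ hδ => mem_Dplus ?_ ?_, ?_⟩
      · simp [path]; linarith
      · simp [path]; nlinarith [mul_nonneg hs hδ.le, sq_nonneg s]
      · rintro ⟨h, -⟩; rw [w_re] at h; simp [path] at h
    · simp only [param, hcc] at hs
      obtain ⟨hs0, hs1⟩ := hs
      refine ⟨mem_closure_Dplus (v := Complex.I) fun δ hδ => mem_Dplus ?_ ?_, ?_⟩
      · simpa [path] using hδ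
      · simp [path]; exact mul_neg_of_pos_of_neg hs0 (by nlinarith)
      · rintro ⟨h, -⟩; rw [w_re] at h; simp [path] at h
    · simp only [param, hcc] at hs
      have hs : c ≤ s := hs
      have hm := Real.sqrt_nonneg (s ^ 2 - 1 / 2)
      have hm2 := Real.sq_sqrt (show 0 ≤ s ^ 2 - 1 / 2 by nlinarith)
      refine ⟨mem_closure_Dplus (v := Complex.I) fun δ hδ => mem_Dplus ?_ ?_, ?_⟩
      · simp only [path, Complex.add_im, Complex.ofReal_im, Complex.mul_im, Complex.I_re,
          Complex.I_im, Complex.ofReal_re]; linarith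
      · simp only [path, Complex.add_im, Complex.add_re, Complex.ofReal_im, Complex.mul_im,
          Complex.mul_re, Complex.I_re, Complex.I_im, Complex.ofReal_re]
        generalize Real.sqrt (s ^ 2 - 1 / 2) = m at *
        apply mul_neg_of_pos_of_neg <;> nlinarith
      · rintro ⟨h, -⟩; rw [w_re] at h
        simp only [path, Complex.add_im, Complex.add_re, Complex.ofReal_im, Complex.mul_im,
          Complex.mul_re, Complex.I_re, Complex.I_im, Complex.ofReal_re] at h
        generalize Real.sqrt (s ^ 2 - 1 / 2) = m at *
        have : 2 * s ^ 2 - 2 * m ^ 2 - 1 = 0 := by linarith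
        have h0 : 2 * m * (s * (2 * s ^ 2 - 2 * m ^ 2 - 1)) < 0 := by ring_nf at h ⊢; linarith
        rw [this] at h0; simp at h0
    · simp only [param, hcc] at hs
      have hs : c ≤ s := hs
      have hm := Real.sqrt_nonneg (s ^ 2 - 1 / 2)
      have hm2 := Real.sq_sqrt (show 0 ≤ s ^ 2 - 1 / 2 by nlinarith)
      refine ⟨mem_closure_Dplus (v := -1 + Complex.I) fun δ hδ => mem_Dplus ?_ ?_, ?_⟩
      · simp only [path, Complex.add_im, Complex.ofReal_im, Complex.mul_im, Complex.I_re,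
          Complex.I_im, Complex.ofReal_re, Complex.neg_im, Complex.one_im]; linarith
      · simp only [path, Complex.add_im, Complex.add_re, Complex.ofReal_im, Complex.mul_im,
          Complex.mul_re, Complex.I_re, Complex.I_im, Complex.ofReal_re, Complex.neg_im,
          Complex.one_im, Complex.neg_re, Complex.one_re]
        generalize Real.sqrt (s ^ 2 - 1 / 2) = m at *
        have : m < s := by nlinarith
        apply mul_neg_of_neg_of_pos <;> nlinarith
      · rintro ⟨h, -⟩; rw [w_re] at h
        simp only [path, Complex.add_im, Complex.add_re, Complex.ofReal_im, Complex.mul_im,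
          Complex.mul_re, Complex.I_re, Complex.I_im, Complex.ofReal_re, Complex.neg_im,
          Complex.neg_re] at h
        generalize Real.sqrt (s ^ 2 - 1 / 2) = m at *
        have : 2 * s ^ 2 - 2 * m ^ 2 - 1 = 0 := by linarith
        have h0 : 2 * m * (-s * (2 * s ^ 2 - 2 * m ^ 2 - 1)) < 0 := by ring_nf at h ⊢; linarith
        rw [this] at h0; simp at h0
    · simp only [param, hcc] at hs
      have hs : s ≤ -c := hs
      refine ⟨mem_closure_Dplus (v := -1 + Complex.I) fun δ hδ => mem_Dplus ?_ ?_, ?_⟩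
      · simpa [path] using hδ
      · simp [path]; apply mul_neg_of_neg_of_pos <;> nlinarith
      · rintro ⟨h, -⟩; rw [w_re] at h; simp [path] at h
  · rintro ⟨hp, hn⟩
    have hcl : IsClosed {k : ℂ | 0 ≤ k.im ∧ k.re * (2 * k.re ^ 2 - 2 * k.im ^ 2 - 1) ≤ 0} :=
      (isClosed_le continuous_const Complex.continuous_im).inter
        (isClosed_le
          (show Continuous fun k : ℂ => k.re * (2 * k.re ^ 2 - 2 * k.im ^ 2 - 1) by fun_prop)
          continuous_const)
    obtain ⟨h1, h2⟩ := closure_minimal (s := Dplus) (fun k hk => by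
      obtain ⟨h, hb⟩ := hk
      rw [w_re] at h
      exact ⟨hb.le, by by_contra! h'; nlinarith [mul_pos hb h']⟩) hcl hp
    obtain ⟨a, b⟩ := p
    simp only at h1 h2
    have key : b = 0 ∨ a = 0 ∨ 2 * a ^ 2 - 2 * b ^ 2 - 1 = 0 := by
      by_contra! h
      refine hn (mem_Dplus (lt_of_le_of_ne h1 h.1.symm) (lt_of_le_of_ne h2 ?_))
      exact mul_ne_zero h.2.1 h.2.2
    have hyp : ∀ h : 2 * a ^ 2 - 2 * b ^ 2 - 1 = 0, Real.sqrt (a ^ 2 - 1 / 2) = b := fun h => by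
      rw [show a ^ 2 - 1 / 2 = b ^ 2 by linarith, Real.sqrt_sq h1]
    have hhyp : 2 * a ^ 2 - 2 * b ^ 2 - 1 = 0 → ∃ i, ∃ s ∈ param i, path i s = ⟨a, b⟩ := by
      intro h
      rcases le_or_gt 0 a with ha | ha
      · refine ⟨2, a, ?_, ?_⟩
        · simp only [param, hcc]; show c ≤ a; nlinarith [sq_nonneg b]
        · apply Complex.ext <;> simp [path, ← hyp h]
      · refine ⟨3, -a, ?_, ?_⟩
        · simp only [param, hcc]; show c ≤ -a; nlinarith [sq_nonneg b]
        · apply Complex.ext <;> simp [path, ← hyp h]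
    rcases key with rfl | rfl | h
    · rcases lt_trichotomy a 0 with ha | rfl | ha
      · refine ⟨4, a, ?_, ?_⟩
        · simp only [param, hcc]; show a ≤ -c
          have : 0 ≤ 2 * a ^ 2 - 1 := by by_contra! h; nlinarith [mul_pos_of_neg_of_neg ha h]
          nlinarith
        · apply Complex.ext <;> simp [path]
      · exact ⟨0, 0, by simp [param], by apply Complex.ext <;> simp [path]⟩
      · have : 2 * a ^ 2 - 1 ≤ 0 := by by_contra! h; nlinarith [mul_pos ha h]
        rcases (show a ≤ c by nlinarith).lt_or_eq with h | h
        · refine ⟨1, a, ?_, by apply Complex.ext <;> simp [path]⟩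
          simp only [param, hcc]; exact ⟨ha, h⟩
        · exact hhyp (by rw [h, hc2]; norm_num)
    · exact ⟨0, b, h1, by apply Complex.ext <;> simp [path]⟩
    · exact hhyp h

lemma hasDerivAt_path (i : Fin 5) {s : ℝ} (hs : s ∈ interior (param i)) :
    HasDerivAt (path i) (velocity i s) s := by
  have hid : HasDerivAt (fun s : ℝ => (s : ℂ)) 1 s := Complex.ofRealCLM.hasDerivAt
  have hroot : 1 / Real.sqrt 2 < s →
      HasDerivAt (fun s : ℝ => Complex.I * (Real.sqrt (s ^ 2 - 1 / 2) : ℝ))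
        (Complex.I * s / (Real.sqrt (s ^ 2 - 1 / 2) : ℝ)) s := fun h => by
    have hc : 0 < 1 / Real.sqrt 2 := by positivity
    have hc2 : (1 / Real.sqrt 2) ^ 2 = 1 / 2 := by
      rw [div_pow, Real.sq_sqrt (by norm_num)]; norm_num
    have hne : s ^ 2 - 1 / 2 ≠ 0 := by nlinarith
    have h1 := (((hasDerivAt_pow 2 s).sub_const (1 / 2)).sqrt hne).ofReal_comp.const_mul Complex.I
    refine h1.congr_deriv ?_
    push_cast
    ring
  fin_cases i
  · simpa [path, velocity] using hid.const_mul Complex.I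
  · simpa [path, velocity] using hid
  · have hs : s ∈ interior (Ici (1 / Real.sqrt 2)) := hs
    rw [interior_Ici] at hs
    exact hid.add (hroot hs)
  · have hs : s ∈ interior (Ici (1 / Real.sqrt 2)) := hs
    rw [interior_Ici] at hs
    exact hid.neg.add (hroot hs)
  · simpa [path, velocity] using hid

lemma sqrtWithArg_sq (z : ℂ) {θ : ℝ} (n : ℤ) (hθ : θ = Complex.arg z + n * (2 * Real.pi)) :
    sqrtWithArg z θ ^ 2 = z := by
  rw [sqrtWithArg, mul_pow, ← Complex.ofReal_pow, Real.sq_sqrt (norm_nonneg z),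
    ← Complex.exp_nat_mul, hθ]
  conv_rhs => rw [← Complex.norm_mul_exp_arg_mul_I z]
  congr 1
  rw [Complex.exp_eq_exp_iff_exists_int]
  refine ⟨n, ?_⟩
  push_cast
  ring

/-- Every branch considered satisfies `ν(k)² = 1 - k²`. -/
lemma sq_of_mem_branches {ν : ℂ → ℂ} (hν : ν ∈ branches) (k : ℂ) : ν k ^ 2 = 1 - k ^ 2 := by
  have hco : ∀ a : ℝ, ∃ n : ℤ, toIcoMod Real.two_pi_pos a (Complex.arg (1 - k ^ 2)) =
      Complex.arg (1 - k ^ 2) + n * (2 * Real.pi) := fun a =>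
    ⟨-toIcoDiv Real.two_pi_pos a (Complex.arg (1 - k ^ 2)), by
      simp [toIcoMod, sub_eq_add_neg]⟩
  have hoc : ∃ n : ℤ, toIocMod Real.two_pi_pos 0 (Complex.arg (1 - k ^ 2)) =
      Complex.arg (1 - k ^ 2) + n * (2 * Real.pi) :=
    ⟨-toIocDiv Real.two_pi_pos 0 (Complex.arg (1 - k ^ 2)), by
      simp [toIocMod, sub_eq_add_neg]⟩
  rcases hν with ⟨ε, -, -, rfl⟩ | rfl
  · obtain ⟨n, hn⟩ := hco ε
    exact sqrtWithArg_sq _ n hn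
  · unfold nuClosed
    split_ifs
    · obtain ⟨n, hn⟩ := hoc
      exact sqrtWithArg_sq _ n hn
    · obtain ⟨n, hn⟩ := hco 0
      exact sqrtWithArg_sq _ n hn

end HalfLine4NLS

end

/-! On `∂D⁺` the symbol `w` is purely imaginary, so `|e^{ikx - w(k)t}| = e^{-x Im k} ≤ 1` for `x >
0`. Hence `W_b` is a sum of five operators `h ↦ ∫ k(x,s) h(s) ds` with bounded kernels `pathKernel`,
applied to `h = PsiHat i`. Each is estimated through `Φ = 𝓕⁻ h` by interpolating between two
endpoints.

`L¹ → L^∞`: moving the Fourier transform from `Φ` onto the kernel leaves the oscillatory integral `∫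
k(x,s) e^{-isy} ds`, which is at most `9 t^{-1/4}` uniformly in `x` and `y`
(`norm_setIntegral_pathKernel_mul_cexp_le`). On the four unbounded paths the phase is a real quartic
plus a linear term, with second derivative at least `t s²` in absolute value, so van der Corput's
lemma applies; the damping `e^{-x Im k}` is monotone in the parameter and costs nothing. The
remaining path has length at most `1 ≤ t^{-1/4}`, and this is where `t ≤ 1` enters.

`L² → L²` (`lintegral_pathKernel_sq_le`): on the real paths the kernel is a Fourier kernel with a
symbol of modulus at most one, and Plancherel applies. On the imaginary axis and the hyperbolic arcs
`Im k` is at least the distance of `s` from the start of the parameter interval, so the kernel is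
dominated by a Laplace kernel, which is bounded on `L²(0,∞)`.

The interpolation `lintegral_rpow_le_of_splitting` cuts `Φ` at a height depending on the level of
the output, and its constant stays bounded as `r → 2` and as `r → ∞`. The kernels need not be
integrable in `s`, so `eLpNorm_integral_kernel_le` works on windows `|s| ≤ R` and concludes by
Fatou's lemma.

For `C²` data, two integrations by parts give `g̃(w) = O(|w|⁻²) = O(|k|⁻⁸)` against a prefactor of
cubic growth, and the singularity of the Jacobian at the vertices of the arcs is integrable. -/

noncomputable section

namespace HalfLine4NLS

/-! ### Fourier transform on `L¹` and `L²`: duality, inversion, Plancherel. -/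

section Plancherel

open FourierTransform SchwartzMap
open scoped ContDiff

/-- The Fourier transform is self-adjoint for the bilinear pairing. -/
theorem integral_fourier_mul {f g : ℝ → ℂ} (hf : Integrable f) (hg : Integrable g) :
    ∫ ξ, 𝓕 f ξ * g ξ = ∫ x, f x * 𝓕 g x := by
  have h := VectorFourier.integral_fourierIntegral_smul_eq_flip (μ := volume) (ν := volume)
    (L := innerₗ ℝ) (e := Real.fourierChar) Real.continuous_fourierChar continuous_inner hf hg
  simp only [flip_innerₗ, smul_eq_mul] at h
  exact h

/-- The inverse Fourier transform is self-adjoint for the bilinear pairing. -/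
theorem integral_fourierInv_mul {f g : ℝ → ℂ} (hf : Integrable f) (hg : Integrable g) :
    ∫ ξ, 𝓕⁻ f ξ * g ξ = ∫ x, f x * 𝓕⁻ g x := by
  have h := integral_fourier_mul hf hg.comp_neg
  rw [← Real.fourierInv_eq_fourier_comp_neg] at h
  rw [← h, ← integral_neg_eq_self]
  simp only [Real.fourierInv_eq_fourier_neg, neg_neg]

/-- Smooth compactly supported functions are Schwartz functions and already separate locally
integrable ones. This turns identities of tempered distributions into identities almost everywhere.
-/
theorem ae_eq_of_integral_schwartz_mul {u v : ℝ → ℂ} (hu : LocallyIntegrable u)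
    (hv : LocallyIntegrable v)
    (h : ∀ φ : 𝓢(ℝ, ℂ), ∫ x, φ x * u x = ∫ x, φ x * v x) : u =ᵐ[volume] v := by
  refine ae_eq_of_integral_contDiff_smul_eq hu hv fun g hg hc => ?_
  have hc' : HasCompactSupport (Complex.ofRealCLM ∘ g) := hc.comp_left rfl
  have hg' : ContDiff ℝ ∞ (Complex.ofRealCLM ∘ g) := by fun_prop
  simpa using h (hc'.toSchwartzMap hg')

theorem continuous_fourier {h : ℝ → ℂ} (hh : Integrable h) : Continuous (𝓕 h) :=
  VectorFourier.fourierIntegral_continuous Real.continuous_fourierChar (by fun_prop) hh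

theorem continuous_fourierInv {h : ℝ → ℂ} (hh : Integrable h) : Continuous (𝓕⁻ h) := by
  rw [Real.fourierInv_eq_fourier_comp_neg]
  exact continuous_fourier hh.comp_neg

theorem norm_fourierInv_le {h : ℝ → ℂ} (x : ℝ) : ‖𝓕⁻ h x‖ ≤ ∫ s, ‖h s‖ := by
  rw [Real.fourierInv_eq_fourier_neg]
  exact VectorFourier.norm_fourierIntegral_le_integral_norm _ _ _ _ _

/-- The `L²` Fourier transform agrees with the Fourier integral on integrable functions. -/
theorem fourier_Lp_ae_eq {v : Lp (α := ℝ) ℂ 2} {h : ℝ → ℂ} (hh : Integrable h)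
    (hv : v =ᵐ[volume] h) : (𝓕 v : Lp (α := ℝ) ℂ 2) =ᵐ[volume] 𝓕 h := by
  refine ae_eq_of_integral_schwartz_mul ((Lp.memLp (𝓕 v)).locallyIntegrable one_le_two)
    (continuous_fourier hh).locallyIntegrable fun φ => ?_
  -- The `L²` transform passes to the test function by the definition on distributions, the Fourier
  -- integral by Fubini; both give `∫ 𝓕 φ · h`.
  have h1 := Lp.toTemperedDistribution_apply (𝓕 v) φ
  rw [← Lp.fourier_toTemperedDistribution_eq, TemperedDistribution.fourier_apply,
    Lp.toTemperedDistribution_apply] at h1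
  simp only [smul_eq_mul] at h1
  rw [← h1, ← integral_fourier_mul φ.integrable hh]
  refine integral_congr_ae ?_
  filter_upwards [hv] with x hx
  rw [hx, SchwartzMap.fourier_coe]

/-- Fourier inversion in `L²` for an integrable function whose inverse transform is in `L²`. -/
theorem fourier_toLp_fourierInv {h : ℝ → ℂ} (hh : Integrable h) (hΦ : MemLp (𝓕⁻ h) 2) :
    (𝓕 (hΦ.toLp _) : Lp (α := ℝ) ℂ 2) =ᵐ[volume] h := by
  refine ae_eq_of_integral_schwartz_mul ((Lp.memLp _).locallyIntegrable one_le_two)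
    hh.locallyIntegrable fun φ => ?_
  have h1 := Lp.toTemperedDistribution_apply (𝓕 (hΦ.toLp _)) φ
  rw [← Lp.fourier_toTemperedDistribution_eq, TemperedDistribution.fourier_apply,
    Lp.toTemperedDistribution_apply] at h1
  simp only [smul_eq_mul] at h1
  rw [← h1]
  have h2 : ∫ x, (𝓕 φ) x * hΦ.toLp _ x = ∫ x, (𝓕 φ) x * 𝓕⁻ h x := by
    refine integral_congr_ae ?_
    filter_upwards [hΦ.coeFn_toLp] with x hx
    rw [hx]
  rw [h2, ← integral_fourierInv_mul (𝓕 φ).integrable hh, ← SchwartzMap.fourierInv_coe,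
    FourierTransform.fourierInv_fourier_eq]

theorem eLpNorm_coe_fourier (v : Lp (α := ℝ) ℂ 2) :
    eLpNorm (𝓕 v : Lp (α := ℝ) ℂ 2) 2 volume = eLpNorm v 2 volume := by
  rw [← Lp.enorm_def, ← Lp.enorm_def, enorm_eq_iff_norm_eq]
  exact Lp.norm_fourier_eq v

/-- Plancherel's theorem on `L¹ ∩ L²`. -/
theorem eLpNorm_two_fourier {h : ℝ → ℂ} (hh : Integrable h) (h2 : MemLp h 2) :
    eLpNorm (𝓕 h) 2 volume = eLpNorm h 2 volume := by
  rw [← eLpNorm_congr_ae (fourier_Lp_ae_eq hh h2.coeFn_toLp), eLpNorm_coe_fourier,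
    eLpNorm_congr_ae h2.coeFn_toLp]

end Plancherel

/-! ### Real interpolation between `L¹ → L^∞` and `L² → L²`. -/

section Interpolation

theorem setLIntegral_Ioc_rpow {q G : ℝ} (hq : -1 < q) (hG : 0 ≤ G) :
    ∫⁻ l in Ioc 0 G, ENNReal.ofReal (l ^ q) = ENNReal.ofReal (G ^ (q + 1) / (q + 1)) := by
  rw [← ofReal_integral_eq_lintegral_ofReal, ← intervalIntegral.integral_of_le hG,
    integral_rpow (Or.inl hq), Real.zero_rpow (by linarith), sub_zero]
  · exact (intervalIntegrable_iff_integrableOn_Ioc_of_le hG).1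
      (intervalIntegral.intervalIntegrable_rpow' hq)
  · filter_upwards [ae_restrict_mem measurableSet_Ioc] with l hl using Real.rpow_nonneg hl.1.le q

variable {α β : Type*} [MeasurableSpace α] [MeasurableSpace β] {μ : Measure α} {ν : Measure β}

/-- Real interpolation between a strong `L¹ → L^∞` bound `A` and a strong `L² → L²` bound `B`,
for a pair of functions `f`, `g` that can be split along arbitrary sets; the constant stays
bounded up to both end points. -/
theorem lintegral_rpow_le_of_splitting [SFinite ν] [SFinite μ] {f : α → ℝ≥0} {g : β → ℝ≥0}
    (hf : Measurable f) (hg : Measurable g) {A N p r : ℝ} {B : ℝ≥0∞} (hA : 0 < A) (hN : 0 < N)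
    (hr : 2 < r) (hpr : p + r = p * r)
    (hfN : ∫⁻ y, (f y : ℝ≥0∞) ^ p ∂μ = ENNReal.ofReal N)
    (H : ∀ S : Set α, MeasurableSet S → ∃ u : β → ℝ≥0∞,
      (∀ᵐ x ∂ν, (g x : ℝ≥0∞) ≤ ENNReal.ofReal A * ∫⁻ y in S, f y ∂μ + u x) ∧
        ∫⁻ x, u x ^ 2 ∂ν ≤ B * ∫⁻ y in Sᶜ, (f y : ℝ≥0∞) ^ 2 ∂μ) :
    ∫⁻ x, (g x : ℝ≥0∞) ^ r ∂ν ≤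
      4 * B * ENNReal.ofReal ((2 * A * N) ^ (r - 2)) * ENNReal.ofReal N := by
  have hp1 : 1 < p := by nlinarith
  -- On `S l` one has `f ≤ (l / K) f ^ p`, hence `A ∫_{S l} f ≤ A l N / K`; this `K` makes the bound
  -- exactly `l / 2`.
  set K : ℝ := 2 * A * N with hK
  have hK0 : 0 < K := by positivity
  set S : ℝ → Set α := fun l => {y | K < (f y : ℝ) ^ (p - 1) * l} with hS
  have hSm : ∀ l, MeasurableSet (S l) := fun l =>
    measurableSet_lt measurable_const ((hf.coe_nnreal_real.pow_const _).mul_const _)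
  -- the large part of `f` contributes at most `l / 2`
  have hlarge : ∀ l : ℝ, 0 < l → ENNReal.ofReal A * ∫⁻ y in S l, f y ∂μ ≤ ENNReal.ofReal (l / 2) := by
    intro l hl
    have h1 : ∫⁻ y in S l, f y ∂μ ≤ ∫⁻ y, ENNReal.ofReal (l / K) * (f y : ℝ≥0∞) ^ p ∂μ := by
      refine (setLIntegral_mono (by fun_prop) fun y hy => ?_).trans (setLIntegral_le_lintegral _ _)
      have hy : K < (f y : ℝ) ^ (p - 1) * l := hy
      have hfy : 0 < (f y : ℝ) := by
        rcases (f y).coe_nonneg.eq_or_lt with h | h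
        · rw [← h, Real.zero_rpow (by linarith)] at hy; linarith
        · exact h
      rw [← ENNReal.ofReal_coe_nnreal, ENNReal.ofReal_rpow_of_pos hfy,
        ← ENNReal.ofReal_mul (by positivity)]
      refine ENNReal.ofReal_le_ofReal ?_
      have : (f y : ℝ) ^ p = (f y : ℝ) ^ (p - 1) * f y := by
        rw [Real.rpow_sub_one hfy.ne']; field_simp
      rw [this, div_mul_eq_mul_div, le_div_iff₀ hK0]
      nlinarith
    rw [lintegral_const_mul _ (by fun_prop), hfN, ← ENNReal.ofReal_mul (by positivity)] at h1
    refine (mul_le_mul_right h1 _).trans ?_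
    rw [← ENNReal.ofReal_mul hA.le]
    refine ENNReal.ofReal_le_ofReal (le_of_eq ?_)
    rw [hK]; field_simp
  -- level set estimate
  have hlevel : ∀ l : ℝ, 0 < l →
      ∫⁻ x, {x | l ≤ g x}.indicator (fun x => (g x : ℝ≥0∞) ^ 2 / 4) x ∂ν ≤
        B * ∫⁻ y, (S l)ᶜ.indicator (fun y => (f y : ℝ≥0∞) ^ 2) y ∂μ := by
    intro l hl
    obtain ⟨u, hu1, hu2⟩ := H (S l) (hSm l)
    rw [lintegral_indicator (hSm l).compl]
    refine le_trans (lintegral_mono_ae ?_) hu2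
    filter_upwards [hu1] with x hx
    by_cases hgx : l ≤ g x
    · rw [indicator_of_mem (by exact hgx)]
      -- Where `l ≤ g`, the contribution `l / 2` is at most `g / 2` and can be absorbed, which
      -- leaves `g / 2 ≤ u`.
      have h2 : (g x : ℝ≥0∞) ≤ ((g x / 2 : ℝ≥0) : ℝ≥0∞) + u x := by
        refine hx.trans (add_le_add_left ((hlarge l hl).trans ?_) _)
        rw [← ENNReal.ofReal_coe_nnreal]
        exact ENNReal.ofReal_le_ofReal (by push_cast; linarith)
      have h3 : ((g x / 2 : ℝ≥0) : ℝ≥0∞) ≤ u x := by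
        have : (g x : ℝ≥0∞) = ((g x / 2 : ℝ≥0) : ℝ≥0∞) + ((g x / 2 : ℝ≥0) : ℝ≥0∞) := by
          rw [← ENNReal.coe_add, add_halves]
        rw [this] at h2
        exact (ENNReal.add_le_add_iff_left ENNReal.coe_ne_top).1 h2
      calc (g x : ℝ≥0∞) ^ 2 / 4 = ((g x / 2 : ℝ≥0) : ℝ≥0∞) ^ 2 := by
            rw [← ENNReal.coe_pow, ← ENNReal.coe_pow, div_pow, ENNReal.coe_div (by norm_num)]
            norm_num
        _ ≤ u x ^ 2 := by gcongr
    · rw [indicator_of_notMem (by exact hgx)]; exact zero_le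
  -- integrate in `l`
  have hr2 : 0 < r - 2 := by linarith
  -- Since `g²` itself, and not only `l²`, is integrated over `{l ≤ g}`, the weight is `l ^ (r - 3)`
  -- on both sides. Both integrals in `l` then produce the factor `1 / (r - 2)`, which cancels;
  -- Chebyshev's inequality would lose it as `r → 2`.
  have hint : ∫⁻ l in Ioi (0:ℝ), ENNReal.ofReal (l ^ (r - 3)) *
        ∫⁻ x, {x | l ≤ g x}.indicator (fun x => (g x : ℝ≥0∞) ^ 2 / 4) x ∂ν ≤
      ∫⁻ l in Ioi (0:ℝ), ENNReal.ofReal (l ^ (r - 3)) *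
        (B * ∫⁻ y, (S l)ᶜ.indicator (fun y => (f y : ℝ≥0∞) ^ 2) y ∂μ) :=
    setLIntegral_mono' measurableSet_Ioi fun l hl => by gcongr; exact hlevel l hl
  have hleft : ∫⁻ l in Ioi (0:ℝ), ENNReal.ofReal (l ^ (r - 3)) *
        ∫⁻ x, {x | l ≤ g x}.indicator (fun x => (g x : ℝ≥0∞) ^ 2 / 4) x ∂ν =
      ENNReal.ofReal (1 / (4 * (r - 2))) * ∫⁻ x, (g x : ℝ≥0∞) ^ r ∂ν := by
    have hm : Measurable (Function.uncurry fun (l : ℝ) (x : β) => ENNReal.ofReal (l ^ (r - 3)) *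
        {x | l ≤ g x}.indicator (fun x => (g x : ℝ≥0∞) ^ 2 / 4) x) := by
      refine Measurable.mul (by fun_prop) ?_
      exact Measurable.indicator (f := fun q : ℝ × β => (g q.2 : ℝ≥0∞) ^ 2 / 4)
        (s := {q | q.1 ≤ (g q.2 : ℝ)}) (by fun_prop) (measurableSet_le (by fun_prop) (by fun_prop))
    calc _ = ∫⁻ l in Ioi (0:ℝ), ∫⁻ x, ENNReal.ofReal (l ^ (r - 3)) *
            {x | l ≤ g x}.indicator (fun x => (g x : ℝ≥0∞) ^ 2 / 4) x ∂ν := by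
          refine lintegral_congr fun l => (lintegral_const_mul _ ?_).symm
          exact Measurable.indicator (by fun_prop) (measurableSet_le (by fun_prop) (by fun_prop))
      _ = ∫⁻ x, (∫⁻ l in Ioi (0:ℝ), ENNReal.ofReal (l ^ (r - 3)) *
            {x | l ≤ g x}.indicator (fun x => (g x : ℝ≥0∞) ^ 2 / 4) x) ∂ν :=
          lintegral_lintegral_swap hm.aemeasurable
      _ = ∫⁻ x, ENNReal.ofReal (1 / (4 * (r - 2))) * (g x : ℝ≥0∞) ^ r ∂ν := by
          refine lintegral_congr fun x => ?_
          have h1 : ∀ l : ℝ, ENNReal.ofReal (l ^ (r - 3)) *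
              {x | l ≤ g x}.indicator (fun x => (g x : ℝ≥0∞) ^ 2 / 4) x =
              (Iic (g x : ℝ)).indicator
                (fun l => ENNReal.ofReal (l ^ (r - 3)) * ((g x : ℝ≥0∞) ^ 2 / 4)) l := by
            intro l
            by_cases h : l ≤ g x <;> simp [indicator, h]
          simp only [h1]
          rw [setLIntegral_indicator measurableSet_Iic, inter_comm, Ioi_inter_Iic,
            lintegral_mul_const _ (by fun_prop), setLIntegral_Ioc_rpow (q := r - 3) (by linarith) (g x).coe_nonneg,
            ← ENNReal.ofReal_coe_nnreal, ENNReal.ofReal_rpow_of_nonneg (g x).coe_nonneg (by linarith : (0:ℝ) ≤ r),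
            ← ENNReal.ofReal_pow (g x).coe_nonneg, ← ENNReal.ofReal_ofNat 4,
            ← ENNReal.ofReal_div_of_pos (by norm_num),
            ← ENNReal.ofReal_mul (div_nonneg (by positivity) (by linarith)),
            ← ENNReal.ofReal_mul (by positivity)]
          congr 1
          rw [show r - 3 + 1 = r - 2 by ring]
          rcases (g x).coe_nonneg.eq_or_lt with h | h
          · simp [← h, Real.zero_rpow (by linarith : r ≠ 0)]
          · have : (g x : ℝ) ^ r = (g x : ℝ) ^ (r - 2) * (g x : ℝ) ^ 2 := by
              rw [← Real.rpow_natCast, ← Real.rpow_add h]; congr 1; push_cast; ring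
            rw [this]; field_simp
      _ = _ := lintegral_const_mul _ (by fun_prop)
  have hright : ∫⁻ l in Ioi (0:ℝ), ENNReal.ofReal (l ^ (r - 3)) *
        (B * ∫⁻ y, (S l)ᶜ.indicator (fun y => (f y : ℝ≥0∞) ^ 2) y ∂μ) ≤
      B * (ENNReal.ofReal (K ^ (r - 2) / (r - 2)) * ENNReal.ofReal N) := by
    have hm : Measurable (Function.uncurry fun (l : ℝ) (y : α) => ENNReal.ofReal (l ^ (r - 3)) *
        (S l)ᶜ.indicator (fun y => (f y : ℝ≥0∞) ^ 2) y) := by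
      refine Measurable.mul (by fun_prop) ?_
      refine Measurable.indicator (f := fun q : ℝ × α => (f q.2 : ℝ≥0∞) ^ 2)
        (s := {q | K < (f q.2 : ℝ) ^ (p - 1) * q.1}ᶜ) (by fun_prop) ?_
      exact (measurableSet_lt (by fun_prop) (by fun_prop)).compl
    calc _ = ∫⁻ l in Ioi (0:ℝ), B * ∫⁻ y, ENNReal.ofReal (l ^ (r - 3)) *
            (S l)ᶜ.indicator (fun y => (f y : ℝ≥0∞) ^ 2) y ∂μ := by
          refine lintegral_congr fun l => ?_
          rw [lintegral_const_mul _ (Measurable.indicator (by fun_prop) (hSm l).compl)]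
          ring
      _ = B * ∫⁻ l in Ioi (0:ℝ), ∫⁻ y, ENNReal.ofReal (l ^ (r - 3)) *
            (S l)ᶜ.indicator (fun y => (f y : ℝ≥0∞) ^ 2) y ∂μ :=
          lintegral_const_mul _ hm.lintegral_prod_right'
      _ = B * ∫⁻ y, (∫⁻ l in Ioi (0:ℝ), ENNReal.ofReal (l ^ (r - 3)) *
            (S l)ᶜ.indicator (fun y => (f y : ℝ≥0∞) ^ 2) y) ∂μ := by
          rw [lintegral_lintegral_swap hm.aemeasurable]
      _ ≤ B * ∫⁻ y, ENNReal.ofReal (K ^ (r - 2) / (r - 2)) * (f y : ℝ≥0∞) ^ p ∂μ := by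
          refine mul_le_mul_right (lintegral_mono fun y => ?_) _
          rcases (f y).coe_nonneg.eq_or_lt with h | h
          · have h0 : f y = 0 := by exact_mod_cast h.symm
            have : ∀ l : ℝ, (S l)ᶜ.indicator (fun y => (f y : ℝ≥0∞) ^ 2) y = 0 := by
              intro l; simp [indicator, h0]
            simp [this]
          · have h1 : ∀ l : ℝ, ENNReal.ofReal (l ^ (r - 3)) *
                (S l)ᶜ.indicator (fun y => (f y : ℝ≥0∞) ^ 2) y =
                (Iic (K / (f y : ℝ) ^ (p - 1))).indicator
                  (fun l => ENNReal.ofReal (l ^ (r - 3)) * ((f y : ℝ≥0∞) ^ 2)) l := by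
              intro l
              have h2 : l ≤ K / (f y : ℝ) ^ (p - 1) ↔ y ∈ (S l)ᶜ := by
                rw [le_div_iff₀ (by positivity)]
                simp [S, mul_comm]
              by_cases h : y ∈ (S l)ᶜ
              · rw [indicator_of_mem h, indicator_of_mem (by exact h2.2 h)]
              · rw [indicator_of_notMem h, indicator_of_notMem (by simpa using h2.not.2 h),
                  mul_zero]
            simp only [h1]
            rw [setLIntegral_indicator measurableSet_Iic, inter_comm, Ioi_inter_Iic,
              lintegral_mul_const _ (by fun_prop),
              setLIntegral_Ioc_rpow (q := r - 3) (by linarith) (by positivity),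
              ← ENNReal.ofReal_coe_nnreal, ENNReal.ofReal_rpow_of_pos h,
              ← ENNReal.ofReal_pow h.le,
              ← ENNReal.ofReal_mul (div_nonneg (by positivity) (by linarith)),
              ← ENNReal.ofReal_mul (div_nonneg (by positivity) (by linarith))]
            refine ENNReal.ofReal_le_ofReal (le_of_eq ?_)
            have e1 : r - 3 + 1 = r - 2 := by ring
            -- The duality relation `p + r = p r` says that `(p - 1)(r - 2) = 2 - p`, so precisely
            -- `f ^ p` is left.
            have e2 : ((f y : ℝ) ^ (p - 1)) ^ (r - 2) = (f y : ℝ) ^ (2 - p) := by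
              rw [← Real.rpow_mul h.le]; congr 1; linarith
            have e3 : (f y : ℝ) ^ (2 : ℕ) = (f y : ℝ) ^ p * (f y : ℝ) ^ (2 - p) := by
              rw [← Real.rpow_natCast, ← Real.rpow_add h]; congr 1; push_cast; ring
            rw [e1, Real.div_rpow hK0.le (by positivity), e2, e3]
            field_simp
      _ = _ := by rw [lintegral_const_mul _ (by fun_prop), hfN]
  rw [hleft] at hint
  have := hint.trans hright
  calc ∫⁻ x, (g x : ℝ≥0∞) ^ r ∂ν
      = ENNReal.ofReal (4 * (r - 2)) *
          (ENNReal.ofReal (1 / (4 * (r - 2))) * ∫⁻ x, (g x : ℝ≥0∞) ^ r ∂ν) := by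
        rw [← mul_assoc, ← ENNReal.ofReal_mul (by positivity),
          mul_one_div_cancel (by positivity), ENNReal.ofReal_one, one_mul]
    _ ≤ ENNReal.ofReal (4 * (r - 2)) *
          (B * (ENNReal.ofReal (K ^ (r - 2) / (r - 2)) * ENNReal.ofReal N)) := by gcongr
    _ = 4 * B * ENNReal.ofReal (K ^ (r - 2)) * ENNReal.ofReal N := by
        have : ENNReal.ofReal (4 * (r - 2)) * ENNReal.ofReal (K ^ (r - 2) / (r - 2)) =
            4 * ENNReal.ofReal (K ^ (r - 2)) := by
          rw [← ENNReal.ofReal_mul (by positivity), ← ENNReal.ofReal_ofNat 4,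
            ← ENNReal.ofReal_mul (by positivity)]
          congr 1; field_simp
        calc _ = (ENNReal.ofReal (4 * (r - 2)) * ENNReal.ofReal (K ^ (r - 2) / (r - 2))) * B *
              ENNReal.ofReal N := by ring
          _ = _ := by rw [this]; ring

end Interpolation

/-! ### Van der Corput estimates and monotone amplitudes. -/

section VanDerCorput

open Complex (I)

variable {φ φ' φ'' : ℝ → ℝ}

theorem hasDerivAt_cexp_phase (h1 : ∀ s, HasDerivAt φ (φ' s) s) (s : ℝ) :
    HasDerivAt (fun s => Complex.exp (I * φ s)) (I * φ' s * Complex.exp (I * φ s)) s := by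
  have := ((h1 s).ofReal_comp.const_mul I).cexp
  exact this.congr_deriv (by ring)

theorem norm_cexp_I_mul (x : ℝ) : ‖Complex.exp (I * x)‖ = 1 := by
  rw [mul_comm]; exact Complex.norm_exp_ofReal_mul_I x

theorem norm_integral_phase_le (φ : ℝ → ℝ) {a b : ℝ} (hab : a ≤ b) :
    ‖∫ s in a..b, Complex.exp (I * φ s)‖ ≤ b - a := by
  have := intervalIntegral.norm_integral_le_of_norm_le_const (a := a) (b := b) (C := 1)
    (f := fun s => Complex.exp (I * φ s)) fun s _ => (norm_cexp_I_mul _).le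
  rwa [one_mul, abs_of_nonneg (by linarith)] at this

/-- Van der Corput's lemma for the first derivative. -/
theorem norm_integral_phase_le_of_le_deriv (h1 : ∀ s, HasDerivAt φ (φ' s) s)
    (h2 : ∀ s, HasDerivAt φ' (φ'' s) s) (hc : Continuous φ'') {a b l : ℝ} (hab : a ≤ b)
    (hl : 0 < l) (hφ' : ∀ s ∈ Icc a b, l ≤ φ' s) (hφ'' : ∀ s ∈ Icc a b, 0 ≤ φ'' s) :
    ‖∫ s in a..b, Complex.exp (I * φ s)‖ ≤ 3 / l := by
  have hc1 : Continuous φ := continuous_iff_continuousAt.2 fun s => (h1 s).continuousAt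
  have hc2 : Continuous φ' := continuous_iff_continuousAt.2 fun s => (h2 s).continuousAt
  have hpos : ∀ s ∈ uIcc a b, 0 < φ' s := fun s hs => hl.trans_le (hφ' s (by rwa [uIcc_of_le hab] at hs))
  have hinv : ∀ s ∈ uIcc a b, HasDerivAt (fun s => -(φ' s)⁻¹) (φ'' s / φ' s ^ 2) s := fun s hs =>
    ((h2 s).inv (hpos s hs).ne').neg.congr_deriv (by ring)
  have hint : IntervalIntegrable (fun s => φ'' s / φ' s ^ 2) volume a b :=
    (ContinuousOn.div hc.continuousOn (hc2.pow 2).continuousOn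
      fun s hs => (pow_pos (hpos s hs) 2).ne').intervalIntegrable
  -- The exponential is `(-i / φ')` times its own derivative, which is integrated by parts.
  have hparts := intervalIntegral.integral_mul_deriv_eq_deriv_mul (a := a) (b := b)
    (u := fun s => I * ((-(φ' s)⁻¹ : ℝ) : ℂ)) (u' := fun s => I * ((φ'' s / φ' s ^ 2 : ℝ) : ℂ))
    (v := fun s => Complex.exp (I * φ s)) (v' := fun s => I * φ' s * Complex.exp (I * φ s))
    (fun s hs => (hinv s hs).ofReal_comp.const_mul I) (fun s _ => hasDerivAt_cexp_phase h1 s)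
    (IntervalIntegrable.const_mul ⟨hint.1.ofReal, hint.2.ofReal⟩ I) (by apply Continuous.intervalIntegrable; fun_prop)
  have hL : ∫ s in a..b, Complex.exp (I * φ s) = ∫ s in a..b, I * ((-(φ' s)⁻¹ : ℝ) : ℂ) *
      (I * φ' s * Complex.exp (I * φ s)) := by
    refine intervalIntegral.integral_congr fun s hs => ?_
    have : (φ' s : ℂ) ≠ 0 := by exact_mod_cast (hpos s hs).ne'
    push_cast
    field_simp
    simp
  have hend : ∀ s ∈ Icc a b, ‖I * ((-(φ' s)⁻¹ : ℝ) : ℂ) * Complex.exp (I * φ s)‖ ≤ 1 / l := by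
    intro s hs
    have h := hφ' s hs
    rw [norm_mul, norm_cexp_I_mul, norm_mul, Complex.norm_I, Complex.norm_real, norm_neg,
      Real.norm_of_nonneg (inv_nonneg.2 (hl.le.trans h)), one_mul, mul_one, one_div]
    exact inv_anti₀ hl h
  -- As `φ'' ≥ 0`, the absolute value of the factor is the derivative of `-1 / φ'`, so its integral
  -- telescopes.
  have hmid : ‖∫ s in a..b, I * ((φ'' s / φ' s ^ 2 : ℝ) : ℂ) * Complex.exp (I * φ s)‖ ≤ 1 / l := by
    calc _ ≤ ∫ s in a..b, φ'' s / φ' s ^ 2 := by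
          refine intervalIntegral.norm_integral_le_of_norm_le hab ?_ hint
          refine .of_forall fun s hs => ?_
          rw [norm_mul, norm_cexp_I_mul, norm_mul, Complex.norm_I, Complex.norm_real,
            one_mul, mul_one, Real.norm_of_nonneg]
          exact div_nonneg (hφ'' s ⟨hs.1.le, hs.2⟩) (sq_nonneg _)
      _ = -(φ' b)⁻¹ - -(φ' a)⁻¹ := intervalIntegral.integral_eq_sub_of_hasDerivAt hinv hint
      _ ≤ 1 / l := by
          have ha := inv_anti₀ hl (hφ' a ⟨le_rfl, hab⟩)
          have hb := inv_nonneg.2 (hl.le.trans (hφ' b ⟨hab, le_rfl⟩))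
          rw [one_div]; linarith
  rw [hL, hparts]
  calc _ ≤ 1 / l + 1 / l + 1 / l :=
        (norm_sub_le _ _).trans (add_le_add ((norm_sub_le _ _).trans
          (add_le_add (hend b ⟨hab, le_rfl⟩) (hend a ⟨le_rfl, hab⟩))) hmid)
    _ = 3 / l := by ring

/-- From a nonnegative value `φ'` grows with slope at least `m`, hence exceeds `√m` after the
distance `1 / √m`. That stretch costs its length, and the first-derivative bound costs `3 / √m` on
the rest. -/
theorem norm_integral_phase_le_of_le_deriv2_of_nonneg (h1 : ∀ s, HasDerivAt φ (φ' s) s)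
    (h2 : ∀ s, HasDerivAt φ' (φ'' s) s) (hc : Continuous φ'') {a b m : ℝ} (hab : a ≤ b)
    (hm : 0 < m) (ha : 0 ≤ φ' a) (hφ'' : ∀ s ∈ Icc a b, m ≤ φ'' s) :
    ‖∫ s in a..b, Complex.exp (I * φ s)‖ ≤ 4 / Real.sqrt m := by
  have hsq : 0 < Real.sqrt m := Real.sqrt_pos.2 hm
  have hc1 : Continuous φ := continuous_iff_continuousAt.2 fun s => (h1 s).continuousAt
  have hc2 : Continuous φ' := continuous_iff_continuousAt.2 fun s => (h2 s).continuousAt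
  set d : ℝ := 1 / Real.sqrt m with hd
  have hd0 : 0 < d := by positivity
  rcases le_or_gt b (a + d) with h | h
  · refine (norm_integral_phase_le φ hab).trans ?_
    calc b - a ≤ d := by linarith
      _ ≤ 4 / Real.sqrt m := by rw [hd]; gcongr; norm_num
  · have hint : ∀ x y, IntervalIntegrable (fun s => Complex.exp (I * φ s)) volume x y := fun x y => by
      apply Continuous.intervalIntegrable; fun_prop
    rw [← intervalIntegral.integral_add_adjacent_intervals (hint a (a + d)) (hint (a + d) b)]
    have hA := norm_integral_phase_le φ (a := a) (b := a + d) (by linarith)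
    have hB := norm_integral_phase_le_of_le_deriv h1 h2 hc (a := a + d) (b := b)
      (l := Real.sqrt m) h.le hsq (fun s hs => ?_)
      (fun s hs => hm.le.trans (hφ'' s ⟨by linarith [hs.1], hs.2⟩))
    · calc _ ≤ d + 3 / Real.sqrt m := (norm_add_le _ _).trans (add_le_add (by linarith) hB)
        _ = 4 / Real.sqrt m := by rw [hd]; ring
    · have hmv := (convex_Icc a b).mul_sub_le_image_sub_of_le_deriv hc2.continuousOn
        (fun s _ => (h2 s).differentiableAt.differentiableWithinAt) (C := m)
        (fun s hs => by rw [(h2 s).deriv]; exact hφ'' s (interior_subset hs))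
        a ⟨le_rfl, hab⟩ s ⟨by linarith [hs.1], hs.2⟩ (by linarith [hs.1])
      have : Real.sqrt m = m * d := by
        rw [hd, mul_one_div, eq_div_iff hsq.ne', Real.mul_self_sqrt hm.le]
      nlinarith [hs.1]

/-- Van der Corput's lemma for the second derivative. -/
theorem norm_integral_phase_le_of_le_deriv2 (h1 : ∀ s, HasDerivAt φ (φ' s) s)
    (h2 : ∀ s, HasDerivAt φ' (φ'' s) s) (hc : Continuous φ'') {a b m : ℝ} (hab : a ≤ b)
    (hm : 0 < m) (hφ'' : ∀ s ∈ Icc a b, m ≤ φ'' s) :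
    ‖∫ s in a..b, Complex.exp (I * φ s)‖ ≤ 8 / Real.sqrt m := by
  have hc1 : Continuous φ := continuous_iff_continuousAt.2 fun s => (h1 s).continuousAt
  have hc2 : Continuous φ' := continuous_iff_continuousAt.2 fun s => (h2 s).continuousAt
  -- The reflection `s ↦ -s` keeps `φ''` and changes the sign of `φ'`.
  have hneg : ∀ c, a ≤ c → c ≤ b → φ' c ≤ 0 →
      ‖∫ s in a..c, Complex.exp (I * φ s)‖ ≤ 4 / Real.sqrt m := by
    intro c hac hcb h
    have := norm_integral_phase_le_of_le_deriv2_of_nonneg (φ := fun s => φ (-s))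
      (φ' := fun s => -φ' (-s)) (φ'' := fun s => φ'' (-s))
      (fun s => ((h1 (-s)).scomp s (hasDerivAt_neg s)).congr_deriv (by simp))
      (fun s => ((h2 (-s)).scomp s (hasDerivAt_neg s)).neg.congr_deriv (by simp))
      (by fun_prop) (neg_le_neg hac) hm (by simpa using h)
      (fun s hs => hφ'' (-s) ⟨by linarith [hs.2], by linarith [hs.1]⟩)
    rwa [intervalIntegral.integral_comp_neg (fun s => Complex.exp (I * φ s)), neg_neg, neg_neg]
      at this
  have hpos : ∀ c, a ≤ c → c ≤ b → 0 ≤ φ' c →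
      ‖∫ s in c..b, Complex.exp (I * φ s)‖ ≤ 4 / Real.sqrt m := fun c hac hcb h =>
    norm_integral_phase_le_of_le_deriv2_of_nonneg h1 h2 hc hcb hm h
      fun s hs => hφ'' s ⟨hac.trans hs.1, hs.2⟩
  have h48 : 4 / Real.sqrt m ≤ 8 / Real.sqrt m := by gcongr; norm_num
  rcases le_total 0 (φ' a) with h | ha
  · exact (hpos a le_rfl hab h).trans h48
  rcases le_total (φ' b) 0 with h | hb
  · exact (hneg b hab le_rfl h).trans h48
  obtain ⟨c, hc', hc0⟩ := intermediate_value_Icc hab hc2.continuousOn ⟨ha, hb⟩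
  have hint : ∀ x y, IntervalIntegrable (fun s => Complex.exp (I * φ s)) volume x y := fun x y => by
    apply Continuous.intervalIntegrable; fun_prop
  rw [← intervalIntegral.integral_add_adjacent_intervals (hint a c) (hint c b)]
  calc _ ≤ 4 / Real.sqrt m + 4 / Real.sqrt m := (norm_add_le _ _).trans
        (add_le_add (hneg c hc'.1 hc'.2 hc0.le) (hpos c hc'.1 hc'.2 hc0.ge))
    _ = 8 / Real.sqrt m := by ring

/-- An oscillatory integral whose phase satisfies `φ'' ≥ t s²` is `O(t^{-1/4})`. -/
theorem norm_integral_quartic_phase_le (h1 : ∀ s, HasDerivAt φ (φ' s) s)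
    (h2 : ∀ s, HasDerivAt φ' (φ'' s) s) (hc : Continuous φ'') {a b t : ℝ} (ht : 0 < t)
    (ha : 0 ≤ a) (hab : a ≤ b) (hφ'' : ∀ s ∈ Icc a b, t * s ^ 2 ≤ φ'' s) :
    ‖∫ s in a..b, Complex.exp (I * φ s)‖ ≤ 9 * t ^ (-(1 / 4) : ℝ) := by
  have hc1 : Continuous φ := continuous_iff_continuousAt.2 fun s => (h1 s).continuousAt
  -- The cut `d` balances both parts: below it the length is at most `d`, above it `φ'' ≥ t d² =
  -- d⁻²` and the second-derivative bound is `8 d`.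
  set d : ℝ := t ^ (-(1 / 4) : ℝ) with hd
  have hd0 : 0 < d := by positivity
  have htd : t * d ^ 2 = (d⁻¹) ^ 2 := by
    have : t = (d⁻¹) ^ 4 := by
      rw [hd, ← Real.rpow_neg ht.le, neg_neg, ← Real.rpow_natCast, ← Real.rpow_mul ht.le]; norm_num
    rw [this]; field_simp
  have hfar : ∀ x, a ≤ x → d ≤ x → x ≤ b → ‖∫ s in x..b, Complex.exp (I * φ s)‖ ≤ 8 * d := by
    intro x hax hdx hxb
    have := norm_integral_phase_le_of_le_deriv2 h1 h2 hc hxb (m := t * d ^ 2) (by positivity)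
      fun s hs => le_trans (by gcongr; exact hdx.trans hs.1) (hφ'' s ⟨hax.trans hs.1, hs.2⟩)
    rwa [htd, Real.sqrt_sq (by positivity), div_inv_eq_mul] at this
  rcases le_total b d with hb | hb
  · exact (norm_integral_phase_le φ hab).trans (by linarith)
  rcases le_total d a with had | had
  · exact (hfar a le_rfl had hab).trans (by linarith)
  have hint : ∀ x y, IntervalIntegrable (fun s => Complex.exp (I * φ s)) volume x y := fun x y => by
    apply Continuous.intervalIntegrable; fun_prop
  rw [← intervalIntegral.integral_add_adjacent_intervals (hint a d) (hint d b)]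
  have := norm_integral_phase_le φ had
  calc _ ≤ d + 8 * d := (norm_add_le _ _).trans
        (add_le_add (by linarith) (hfar d had le_rfl hb))
    _ = 9 * d := by ring

/-- A decreasing amplitude with values in `[0, 1]` does not increase the bound for the
primitives of an integrand. -/
theorem norm_integral_antitone_mul_le {A : ℝ → ℝ} {f : ℝ → ℂ} {a b M : ℝ} (hab : a ≤ b)
    (hf : IntegrableOn f (Ioc a b)) (hA : Measurable A) (hanti : AntitoneOn A (Icc a b))
    (hA0 : ∀ s ∈ Icc a b, 0 ≤ A s) (hA1 : ∀ s ∈ Icc a b, A s ≤ 1)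
    (hM : ∀ u ∈ Icc a b, ‖∫ s in a..u, f s‖ ≤ M) :
    ‖∫ s in a..b, (A s : ℂ) * f s‖ ≤ M := by
  have hint : Integrable (Function.uncurry fun (s l : ℝ) => {q : ℝ × ℝ | q.2 < A q.1}.indicator
      (fun q => f q.1) (s, l)) ((volume.restrict (Ioc a b)).prod (volume.restrict (Ioc 0 1))) := by
    have := (hf.mul_prod (integrable_const (1 : ℂ) (μ := volume.restrict (Ioc (0:ℝ) 1)))).indicator
      (measurableSet_lt measurable_snd (hA.comp measurable_fst))
    simpa [Function.uncurry_def] using this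
  -- Layer-cake formula: `A s` is the length of the set of levels `l ∈ (0, 1]` below `A s`. Each
  -- slice will be a primitive of `f`, so averaging over `l` keeps the bound `M`.
  have hlayer : ∫ s in a..b, (A s : ℂ) * f s = ∫ l in Ioc (0 : ℝ) 1, ∫ s in Ioc a b,
      {q : ℝ × ℝ | q.2 < A q.1}.indicator (fun q => f q.1) (s, l) := by
    rw [intervalIntegral.integral_of_le hab, ← integral_integral_swap hint]
    refine setIntegral_congr_fun measurableSet_Ioc fun s hs => ?_
    have hs' : s ∈ Icc a b := ⟨hs.1.le, hs.2⟩
    have : ∀ l, {q : ℝ × ℝ | q.2 < A q.1}.indicator (fun q => f q.1) (s, l) =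
        (Iio (A s)).indicator (fun _ => f s) l := fun l => by simp [indicator]
    simp only [this]
    rw [setIntegral_indicator measurableSet_Iio, setIntegral_const]
    have hset : (volume : Measure ℝ).real (Ioc 0 1 ∩ Iio (A s)) = A s := by
      have h1 : Ioo 0 (A s) ⊆ Ioc 0 1 ∩ Iio (A s) := fun l hl =>
        ⟨⟨hl.1, hl.2.le.trans (hA1 s hs')⟩, hl.2⟩
      have h2 : Ioc 0 1 ∩ Iio (A s) ⊆ Ioo 0 (A s) := fun l hl => ⟨hl.1.1, hl.2⟩
      rw [h2.antisymm h1]; simp [hA0 s hs']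
    rw [hset]; simp
  rw [hlayer]
  have hslice : ∀ l : ℝ, ‖∫ s in Ioc a b,
      {q : ℝ × ℝ | q.2 < A q.1}.indicator (fun q => f q.1) (s, l)‖ ≤ M := by
    intro l
    have : ∀ s, {q : ℝ × ℝ | q.2 < A q.1}.indicator (fun q => f q.1) (s, l) =
        {s | l < A s}.indicator f s := fun s => by simp [indicator]
    simp only [this]
    rw [setIntegral_indicator (measurableSet_lt measurable_const hA)]
    rcases (Icc a b ∩ {s | l < A s}).eq_empty_or_nonempty with he | hne
    · have : Ioc a b ∩ {s | l < A s} = ∅ :=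
        subset_empty_iff.1 (he ▸ inter_subset_inter_left _ Ioc_subset_Icc_self)
      rw [this]
      simpa using hM a ⟨le_rfl, hab⟩
    -- Because `A` decreases, the superlevel set is an initial interval up to `u`; whether `u`
    -- belongs to it is a null-set matter.
    · set u := sSup (Icc a b ∩ {s | l < A s}) with hu
      have hbdd : BddAbove (Icc a b ∩ {s | l < A s}) := ⟨b, fun s hs => hs.1.2⟩
      have hub : u ≤ b := csSup_le hne fun s hs => hs.1.2
      have hua : a ≤ u := by
        obtain ⟨s, hs⟩ := hne
        exact hs.1.1.trans (le_csSup hbdd hs)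
      have hae : (Ioc a b ∩ {s | l < A s} : Set ℝ) =ᵐ[volume] Ioc a u := by
        refine Filter.EventuallyLE.antisymm (Filter.Eventually.of_forall fun s hs => ?_) ?_
        · exact ⟨hs.1.1, le_csSup hbdd ⟨Ioc_subset_Icc_self hs.1, hs.2⟩⟩
        · refine Ioo_ae_eq_Ioc.symm.le.trans (Filter.Eventually.of_forall fun s hs => ?_)
          obtain ⟨s', hs', hlt⟩ := exists_lt_of_lt_csSup hne hs.2
          have hsI : s ∈ Icc a b := ⟨hs.1.le, hs.2.le.trans hub⟩
          exact ⟨⟨hs.1, hsI.2⟩, hs'.2.trans_le (hanti hsI hs'.1 hlt.le)⟩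
      rw [setIntegral_congr_set hae, ← intervalIntegral.integral_of_le hua]
      exact hM u ⟨hua, hub⟩
  have := norm_setIntegral_le_of_norm_le_const (μ := volume) (s := Ioc (0:ℝ) 1) (by simp)
    fun l _ => hslice l
  simpa using this

theorem norm_integral_antitone_mul_quartic_phase_le {A : ℝ → ℝ}
    (h1 : ∀ s, HasDerivAt φ (φ' s) s)
    (h2 : ∀ s, HasDerivAt φ' (φ'' s) s) (hc : Continuous φ'') {a b t : ℝ} (ht : 0 < t)
    (ha : 0 ≤ a) (hab : a ≤ b) (hφ'' : ∀ s ∈ Icc a b, t * s ^ 2 ≤ φ'' s)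
    (hA : Measurable A) (hanti : AntitoneOn A (Icc a b))
    (hA0 : ∀ s ∈ Icc a b, 0 ≤ A s) (hA1 : ∀ s ∈ Icc a b, A s ≤ 1) :
    ‖∫ s in a..b, (A s : ℂ) * Complex.exp (I * φ s)‖ ≤ 9 * t ^ (-(1 / 4) : ℝ) := by
  have hc1 : Continuous φ := continuous_iff_continuousAt.2 fun s => (h1 s).continuousAt
  refine norm_integral_antitone_mul_le hab ?_ hA hanti hA0 hA1 fun u hu =>
    norm_integral_quartic_phase_le h1 h2 hc ht ha hu.1
      fun s hs => hφ'' s ⟨hs.1, hs.2.trans hu.2⟩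
  exact (by fun_prop : Continuous fun s => Complex.exp (I * φ s)).integrableOn_Ioc

/-- The same bound for the conjugate oscillation. -/
theorem norm_integral_antitone_mul_neg_quartic_phase_le {A : ℝ → ℝ}
    (h1 : ∀ s, HasDerivAt φ (φ' s) s)
    (h2 : ∀ s, HasDerivAt φ' (φ'' s) s) (hc : Continuous φ'') {a b t : ℝ} (ht : 0 < t)
    (ha : 0 ≤ a) (hab : a ≤ b) (hφ'' : ∀ s ∈ Icc a b, t * s ^ 2 ≤ φ'' s)
    (hA : Measurable A) (hanti : AntitoneOn A (Icc a b))
    (hA0 : ∀ s ∈ Icc a b, 0 ≤ A s) (hA1 : ∀ s ∈ Icc a b, A s ≤ 1) :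
    ‖∫ s in a..b, (A s : ℂ) * Complex.exp (-(I * φ s))‖ ≤ 9 * t ^ (-(1 / 4) : ℝ) := by
  have h := norm_integral_antitone_mul_quartic_phase_le h1 h2 hc ht ha hab hφ'' hA hanti hA0 hA1
  rw [← Complex.norm_conj, ← intervalIntegral.intervalIntegral_conj] at h
  simpa [← Complex.exp_conj] using h

end VanDerCorput

/-! ### `L²` bounds for Laplace and Fourier kernels. -/

section LTwoBounds

theorem eLpNorm_two_sq {α E : Type*} [MeasurableSpace α] [NormedAddCommGroup E] (f : α → E)
    (μ : Measure α) : eLpNorm f 2 μ ^ 2 = ∫⁻ x, ‖f x‖ₑ ^ 2 ∂μ := by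
  have := eLpNorm_nnreal_pow_eq_lintegral (μ := μ) (f := f) (p := 2) two_ne_zero
  simpa using this

theorem lintegral_comp_mul_left {f : ℝ → ℝ≥0∞} (hf : Measurable f) {a : ℝ} (ha : a ≠ 0) :
    ∫⁻ x, f (a * x) = ENNReal.ofReal |a⁻¹| * ∫⁻ x, f x := by
  rw [← lintegral_map (μ := volume) hf (measurable_const_mul a), Real.map_volume_mul_left ha,
    lintegral_smul_measure, smul_eq_mul]

theorem setLIntegral_rpow_mul_exp {a r : ℝ} (ha : 0 < a) (hr : 0 < r) :
    ∫⁻ s in Ioi (0 : ℝ), ENNReal.ofReal (s ^ (a - 1) * Real.exp (-(r * s))) =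
      ENNReal.ofReal ((1 / r) ^ a * Real.Gamma a) := by
  have h := Real.integral_rpow_mul_exp_neg_mul_Ioi ha hr
  have hpos : 0 < (1 / r) ^ a * Real.Gamma a := mul_pos (by positivity) (Real.Gamma_pos_of_pos ha)
  rw [← h, ofReal_integral_eq_lintegral_ofReal]
  · exact not_imp_comm.1 integral_undef (h ▸ hpos.ne')
  · filter_upwards [ae_restrict_mem measurableSet_Ioi] with s hs
    exact mul_nonneg (Real.rpow_nonneg (le_of_lt hs) _) (Real.exp_pos _).le

theorem lintegral_mul_sq_le {α : Type*} [MeasurableSpace α] (μ : Measure α) {f g : α → ℝ≥0∞}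
    (hf : AEMeasurable f μ) (hg : AEMeasurable g μ) :
    (∫⁻ x, f x * g x ∂μ) ^ 2 ≤ (∫⁻ x, f x ^ 2 ∂μ) * ∫⁻ x, g x ^ 2 ∂μ := by
  have h := ENNReal.lintegral_mul_le_Lp_mul_Lq μ Real.HolderConjugate.two_two hf hg
  have hsq : ∀ z : ℝ≥0∞, (z ^ (1 / 2 : ℝ)) ^ 2 = z := fun z => by
    rw [← ENNReal.rpow_natCast, ← ENNReal.rpow_mul]; norm_num
  simp only [Pi.mul_apply, ENNReal.rpow_ofNat] at h
  calc _ ≤ ((∫⁻ x, f x ^ 2 ∂μ) ^ (1 / 2 : ℝ) * (∫⁻ x, g x ^ 2 ∂μ) ^ (1 / 2 : ℝ)) ^ 2 := by gcongr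
    _ = _ := by rw [mul_pow, hsq, hsq]

/-- The Laplace transform is bounded by `√π` on `L²(0, ∞)`. -/
theorem lintegral_laplace_sq_le {h : ℝ → ℝ≥0∞} (hh : AEMeasurable h) :
    ∫⁻ x in Ioi (0 : ℝ), (∫⁻ s in Ioi (0 : ℝ), ENNReal.ofReal (Real.exp (-(x * s))) * h s) ^ 2 ≤
      ENNReal.ofReal Real.pi * ∫⁻ s in Ioi (0 : ℝ), h s ^ 2 := by
  have hhr : AEMeasurable h (volume.restrict (Ioi 0)) := hh.restrict
  set w : ℝ → ℝ → ℝ≥0∞ := fun x s => ENNReal.ofReal (s ^ (1 / 2 : ℝ) * Real.exp (-(x * s))) with hw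
  have hwm : Measurable (Function.uncurry w) := by
    simp only [hw, Function.uncurry_def]; fun_prop
  have hpoint : ∀ x ∈ Ioi (0 : ℝ),
      (∫⁻ s in Ioi (0 : ℝ), ENNReal.ofReal (Real.exp (-(x * s))) * h s) ^ 2 ≤
        ∫⁻ s in Ioi (0 : ℝ), ENNReal.ofReal (Real.sqrt Real.pi * x ^ (1 / 2 - 1 : ℝ)) *
          (w x s * h s ^ 2) := by
    intro x hx
    have hx : 0 < x := hx
    -- Schur's test with weights `s^{∓1/4}`: after Cauchy–Schwarz the first factor integrates to
    -- `Γ(1/2) x^{-1/2}`. The later integral in `x` gives `Γ(1/2) s^{-1/2}`, which cancels the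
    -- weight `s^{1/2}`; the product of the two constants is `π`.
    have hsplit : ∫⁻ s in Ioi (0 : ℝ), ENNReal.ofReal (Real.exp (-(x * s))) * h s =
        ∫⁻ s in Ioi (0 : ℝ), ENNReal.ofReal (s ^ (-(1 / 4) : ℝ) * Real.exp (-(x * s) / 2)) *
          (ENNReal.ofReal (s ^ (1 / 4 : ℝ) * Real.exp (-(x * s) / 2)) * h s) := by
      refine setLIntegral_congr_fun measurableSet_Ioi fun s hs => ?_
      have hs : 0 < s := hs
      rw [← mul_assoc, ← ENNReal.ofReal_mul (by positivity)]
      congr 2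
      have h1 : s ^ (-(1 / 4) : ℝ) * s ^ (1 / 4 : ℝ) = 1 := by
        rw [← Real.rpow_add hs]; norm_num
      have h2 : Real.exp (-(x * s)) = Real.exp (-(x * s) / 2) * Real.exp (-(x * s) / 2) := by
        rw [← Real.exp_add]; ring_nf
      rw [h2]
      linear_combination (-(Real.exp (-(x * s) / 2) * Real.exp (-(x * s) / 2))) * h1
    rw [hsplit]
    refine (lintegral_mul_sq_le _ (by fun_prop) (by fun_prop)).trans (le_of_eq ?_)
    have hA : ∫⁻ s in Ioi (0 : ℝ),
        ENNReal.ofReal (s ^ (-(1 / 4) : ℝ) * Real.exp (-(x * s) / 2)) ^ 2 =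
        ENNReal.ofReal (Real.sqrt Real.pi * x ^ (1 / 2 - 1 : ℝ)) := by
      have := setLIntegral_rpow_mul_exp (a := 1 / 2) (by norm_num) hx
      rw [Real.Gamma_one_half_eq] at this
      calc _ = ∫⁻ s in Ioi (0 : ℝ), ENNReal.ofReal (s ^ (1 / 2 - 1 : ℝ) * Real.exp (-(x * s))) := by
            refine setLIntegral_congr_fun measurableSet_Ioi fun s hs => ?_
            have hs : 0 < s := hs
            rw [← ENNReal.ofReal_pow (by positivity), mul_pow, ← Real.exp_nat_mul,
              ← Real.rpow_natCast, ← Real.rpow_mul hs.le]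
            congr 3
            · norm_num
            · push_cast; ring
        _ = _ := by
            rw [this, mul_comm, one_div, Real.inv_rpow hx.le, ← Real.rpow_neg hx.le]
            norm_num
    rw [hA, ← lintegral_const_mul'' _ (by fun_prop)]
    refine setLIntegral_congr_fun measurableSet_Ioi fun s hs => ?_
    have hs : 0 < s := hs
    simp only [hw]
    rw [mul_pow, ← ENNReal.ofReal_pow (by positivity), mul_pow, ← Real.exp_nat_mul,
      ← Real.rpow_natCast (s ^ (1 / 4 : ℝ)), ← Real.rpow_mul hs.le]
    congr 4
    · norm_num
    · push_cast; ring_nf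
  have hj : AEMeasurable (Function.uncurry fun x s =>
      ENNReal.ofReal (Real.sqrt Real.pi * x ^ (1 / 2 - 1 : ℝ)) * (w x s * h s ^ 2))
      ((volume.restrict (Ioi 0)).prod (volume.restrict (Ioi 0))) := by
    refine AEMeasurable.mul (by fun_prop) (hwm.aemeasurable.mul ?_)
    exact (hhr.comp_snd).pow_const 2
  calc _ ≤ ∫⁻ x in Ioi (0 : ℝ), ∫⁻ s in Ioi (0 : ℝ),
        ENNReal.ofReal (Real.sqrt Real.pi * x ^ (1 / 2 - 1 : ℝ)) * (w x s * h s ^ 2) :=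
        setLIntegral_mono' measurableSet_Ioi hpoint
    _ = ∫⁻ s in Ioi (0 : ℝ), ∫⁻ x in Ioi (0 : ℝ),
        ENNReal.ofReal (Real.sqrt Real.pi * x ^ (1 / 2 - 1 : ℝ)) * (w x s * h s ^ 2) :=
        lintegral_lintegral_swap hj
    _ = ∫⁻ s in Ioi (0 : ℝ), ENNReal.ofReal Real.pi * h s ^ 2 := by
        refine setLIntegral_congr_fun measurableSet_Ioi fun s hs => ?_
        have hs : 0 < s := hs
        have h1 : ∀ x, ENNReal.ofReal (Real.sqrt Real.pi * x ^ (1 / 2 - 1 : ℝ)) * (w x s * h s ^ 2) =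
            ENNReal.ofReal (Real.sqrt Real.pi * s ^ (1 / 2 : ℝ)) * h s ^ 2 *
              ENNReal.ofReal (x ^ (1 / 2 - 1 : ℝ) * Real.exp (-(s * x))) := by
          intro x
          simp only [hw]
          rw [ENNReal.ofReal_mul (by positivity), ENNReal.ofReal_mul (by positivity),
            ENNReal.ofReal_mul (by positivity), ENNReal.ofReal_mul' (by positivity), mul_comm s x]
          ring
        simp only [h1]
        rw [lintegral_const_mul _ (by fun_prop), setLIntegral_rpow_mul_exp (by norm_num) hs,
          Real.Gamma_one_half_eq, mul_right_comm, ← ENNReal.ofReal_mul (by positivity)]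
        congr 2
        rw [one_div s, Real.inv_rpow hs.le]
        have : s ^ (1 / 2 : ℝ) ≠ 0 := by positivity
        field_simp
        exact Real.sq_sqrt Real.pi_pos.le
    _ = _ := lintegral_const_mul'' _ (by fun_prop)

/-- `L²` bound for a kernel dominated by a Laplace kernel. -/
theorem lintegral_sq_le_of_norm_le_exp {a : ℝ → ℝ → ℂ} {c : ℝ}
    (ha0 : ∀ x s, s < c → a x s = 0)
    (ha : ∀ x s, 0 < x → c ≤ s → ‖a x s‖ ≤ Real.exp (-(x * (s - c)))) {h : ℝ → ℂ}
    (hh : AEStronglyMeasurable h) :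
    ∫⁻ x in Ioi (0 : ℝ), ‖∫ s, a x s * h s‖ₑ ^ 2 ≤ 8 * ∫⁻ s, ‖h s‖ₑ ^ 2 := by
  have hmp : MeasurePreserving (fun s : ℝ => s + c) volume volume := measurePreserving_add_right _ c
  have hh' : AEMeasurable fun s => ‖h (s + c)‖ₑ :=
    (hh.comp_quasiMeasurePreserving hmp.quasiMeasurePreserving).enorm
  calc _ ≤ ∫⁻ x in Ioi (0 : ℝ),
        (∫⁻ s in Ioi (0 : ℝ), ENNReal.ofReal (Real.exp (-(x * s))) * ‖h (s + c)‖ₑ) ^ 2 := by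
        refine setLIntegral_mono' measurableSet_Ioi fun x hx => ?_
        gcongr
        calc _ ≤ ∫⁻ s, ‖a x s * h s‖ₑ := enorm_integral_le_lintegral_enorm _
          _ = ∫⁻ s, ‖a x (s + c) * h (s + c)‖ₑ :=
              (lintegral_add_right_eq_self (fun s => ‖a x s * h s‖ₑ) c).symm
          _ ≤ ∫⁻ s, (Ici 0).indicator
                (fun s => ENNReal.ofReal (Real.exp (-(x * s))) * ‖h (s + c)‖ₑ) s := by
              refine lintegral_mono fun s => ?_
              by_cases hs : 0 ≤ s
              · rw [indicator_of_mem (by exact hs), enorm_mul]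
                gcongr
                rw [← ofReal_norm]
                refine ENNReal.ofReal_le_ofReal ?_
                have := ha x (s + c) hx (by linarith)
                rwa [add_sub_cancel_right] at this
              · rw [ha0 x (s + c) (by linarith), zero_mul, enorm_zero]; exact zero_le
          _ = _ := by
              rw [lintegral_indicator measurableSet_Ici, setLIntegral_congr Ioi_ae_eq_Ici.symm]
    _ ≤ ENNReal.ofReal Real.pi * ∫⁻ s in Ioi (0 : ℝ), ‖h (s + c)‖ₑ ^ 2 :=
        lintegral_laplace_sq_le hh'
    _ ≤ 8 * ∫⁻ s, ‖h (s + c)‖ₑ ^ 2 := by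
        gcongr
        · rw [← ENNReal.ofReal_ofNat 8]
          exact ENNReal.ofReal_le_ofReal (by linarith [Real.pi_lt_four])
        · exact Measure.restrict_le_self
    _ = _ := by rw [lintegral_add_right_eq_self (fun s => ‖h s‖ₑ ^ 2) c]

/-- `L²` bound for a Fourier kernel with bounded symbol. -/
theorem lintegral_sq_fourier_symbol_le {b : ℝ → ℂ} (hb : Measurable b) (hb1 : ∀ s, ‖b s‖ ≤ 1)
    {h : ℝ → ℂ} (hh : Integrable h) (h2 : MemLp h 2) :
    ∫⁻ x in Ioi (0 : ℝ), ‖∫ s : ℝ, Complex.exp (Complex.I * s * x) * b s * h s‖ₑ ^ 2 ≤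
      8 * ∫⁻ s, ‖h s‖ₑ ^ 2 := by
  have hle : ∀ s, ‖b s * h s‖ ≤ ‖h s‖ := fun s => by
    rw [norm_mul]; exact mul_le_of_le_one_left (norm_nonneg _) (hb1 s)
  have hm : AEStronglyMeasurable (fun s => b s * h s) :=
    hb.aestronglyMeasurable.mul hh.aestronglyMeasurable
  have hH : Integrable fun s => b s * h s := hh.mono hm (.of_forall hle)
  have hH2 : MemLp (fun s => b s * h s) 2 := h2.mono hm (.of_forall hle)
  -- Passing to the normalization `e^{-2πisξ}` rescales `x`, which costs the factor `2π ≤ 8`.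
  have hF : ∀ x : ℝ, ∫ s : ℝ, Complex.exp (Complex.I * s * x) * b s * h s =
      FourierTransform.fourier (fun s => b s * h s) (-(2 * Real.pi)⁻¹ * x) := by
    intro x
    rw [Real.fourier_real_eq_integral_exp_smul]
    refine integral_congr_ae (.of_forall fun s => ?_)
    simp only [smul_eq_mul]
    rw [mul_assoc]
    congr 2
    push_cast
    have : (Real.pi : ℂ) ≠ 0 := by exact_mod_cast Real.pi_ne_zero
    field_simp
  have hpl := eLpNorm_two_fourier hH hH2
  calc _ ≤ ∫⁻ x : ℝ,
        ‖FourierTransform.fourier (fun s => b s * h s) (-(2 * Real.pi)⁻¹ * x)‖ₑ ^ 2 := by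
        simp only [hF]; exact lintegral_mono' Measure.restrict_le_self le_rfl
    _ = ENNReal.ofReal |(-(2 * Real.pi)⁻¹)⁻¹| *
          ∫⁻ x, ‖FourierTransform.fourier (fun s => b s * h s) x‖ₑ ^ 2 :=
        lintegral_comp_mul_left
          (f := fun x => ‖FourierTransform.fourier (fun s => b s * h s) x‖ₑ ^ 2)
          ((continuous_fourier hH).enorm.measurable.pow_const 2)
          (by simp [Real.pi_ne_zero])
    _ = ENNReal.ofReal (2 * Real.pi) * ∫⁻ s, ‖b s * h s‖ₑ ^ 2 := by
        rw [← eLpNorm_two_sq, hpl, eLpNorm_two_sq, inv_neg, inv_inv, abs_neg,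
          abs_of_pos Real.two_pi_pos]
    _ ≤ _ := by
        gcongr with s
        · rw [← ENNReal.ofReal_ofNat 8]
          exact ENNReal.ofReal_le_ofReal (by linarith [Real.pi_lt_four])
        · rw [← ofReal_norm, ← ofReal_norm]
          exact ENNReal.ofReal_le_ofReal (hle s)

end LTwoBounds

/-! ### The abstract dispersive estimate. -/

section Dispersive

open FourierTransform

/-- Pointwise `|Φ|² ≤ M^{2-q} |Φ|^q`, where `q` is the exponent `p` as a real number. Applied to `Φ
= 𝓕⁻ h`, which is bounded because `h` is integrable, it makes the `L²` theory available. -/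
theorem memLp_two_of_bounded {Φ : ℝ → ℂ} {M : ℝ} (hM : ∀ y, ‖Φ y‖ ≤ M) {p : ℝ≥0∞}
    (hΦ : MemLp Φ p) (hp1 : 1 ≤ p) (hp2 : p ≤ 2) : MemLp Φ 2 := by
  have hp0 : p ≠ 0 := (zero_lt_one.trans_le hp1).ne'
  have hpt : p ≠ ∞ := (hp2.trans_lt ENNReal.ofNat_lt_top).ne
  refine ⟨hΦ.1, ?_⟩
  have h1 := (eLpNorm_lt_top_iff_lintegral_rpow_enorm_lt_top hp0 hpt).1 hΦ.2
  rw [eLpNorm_lt_top_iff_lintegral_rpow_enorm_lt_top two_ne_zero ENNReal.ofNat_ne_top]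
  set q := p.toReal
  have hq0 : 0 ≤ q := ENNReal.toReal_nonneg
  have hq2 : 0 ≤ 2 - q := by
    have := ENNReal.toReal_mono ENNReal.ofNat_ne_top hp2
    simp only [ENNReal.toReal_ofNat] at this
    linarith
  calc ∫⁻ y, ‖Φ y‖ₑ ^ (2 : ℝ≥0∞).toReal
      ≤ ∫⁻ y, ENNReal.ofReal M ^ (2 - q) * ‖Φ y‖ₑ ^ q := by
        refine lintegral_mono fun y => ?_
        rw [ENNReal.toReal_ofNat, show (2 : ℝ) = (2 - q) + q by ring,
          ENNReal.rpow_add_of_nonneg _ _ hq2 hq0, show (2 - q) + q - q = 2 - q by ring]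
        gcongr
        rw [← ofReal_norm]
        exact ENNReal.ofReal_le_ofReal (hM y)
    _ = ENNReal.ofReal M ^ (2 - q) * ∫⁻ y, ‖Φ y‖ₑ ^ q :=
        lintegral_const_mul' _ _ (ENNReal.rpow_ne_top_of_nonneg hq2 ENNReal.ofReal_ne_top)
    _ < ∞ := ENNReal.mul_lt_top (ENNReal.rpow_lt_top_of_nonneg hq2 ENNReal.ofReal_ne_top) h1

variable {k : ℝ → ℝ → ℂ} {A : ℝ} {h : ℝ → ℂ}

theorem aestronglyMeasurable_integral_kernel (hk : Measurable (Function.uncurry k))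
    (hh : AEStronglyMeasurable h) (J : Set ℝ) (μ : Measure ℝ) [SFinite μ] :
    AEStronglyMeasurable (fun x => ∫ s in J, k x s * h s) μ := by
  refine AEStronglyMeasurable.integral_prod_right'
    (f := fun q : ℝ × ℝ => k q.1 q.2 * h q.2) ?_
  exact hk.aestronglyMeasurable.mul hh.restrict.comp_snd

/-- For data `h = 𝓕 Φ`, the truncated operator with kernel `k` splits along any decomposition of
`Φ` by a measurable set into an `L¹ → L^∞` and an `L² → L²` part. -/
theorem exists_splitting (hk : Measurable (Function.uncurry k))
    (hk1 : ∀ x s, 0 < x → ‖k x s‖ ≤ 1) (hA : 0 < A)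
    (hosc : ∀ x R y : ℝ, 0 < x → ‖∫ s in Icc (-R) R, k x s * Complex.exp (-(Complex.I * s * y))‖ ≤ A)
    (hL2 : ∀ f, Integrable f → MemLp f 2 →
      ∫⁻ x in Ioi (0 : ℝ), ‖∫ s, k x s * f s‖ₑ ^ 2 ≤ 8 * ∫⁻ s, ‖f s‖ₑ ^ 2)
    (hh : Integrable h) (hΦ : MemLp (𝓕⁻ h) 2) (R : ℝ) {S : Set ℝ} (hS : MeasurableSet S) :
    ∃ u : ℝ → ℝ≥0∞, (∀ᵐ x ∂volume.restrict (Ioi (0 : ℝ)), ‖∫ s in Icc (-R) R, k x s * h s‖ₑ ≤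
        ENNReal.ofReal A * (∫⁻ y in S, ‖𝓕⁻ h y‖ₑ) + u x) ∧
      AEMeasurable u (volume.restrict (Ioi 0)) ∧
      ∫⁻ x in Ioi (0 : ℝ), u x ^ 2 ≤ 8 * ∫⁻ y in Sᶜ, ‖𝓕⁻ h y‖ₑ ^ 2 := by
  by_cases htop : ∫⁻ y in S, ‖𝓕⁻ h y‖ₑ = ∞
  · refine ⟨0, .of_forall fun x => ?_, aemeasurable_const, by simp⟩
    rw [htop, ENNReal.mul_top (by simpa using hA)]
    simp
  set f1 : ℝ → ℂ := S.indicator (𝓕⁻ h)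
  set f2 : ℝ → ℂ := Sᶜ.indicator (𝓕⁻ h)
  have hf1 : MemLp f1 2 := hΦ.indicator hS
  have hf2 : MemLp f2 2 := hΦ.indicator hS.compl
  have hf1i : Integrable f1 := by
    rw [integrable_indicator_iff hS]
    exact ⟨hΦ.1.restrict, lt_top_iff_ne_top.2 htop⟩
  have hsum : hΦ.toLp _ = hf1.toLp _ + hf2.toLp _ := by
    rw [← MemLp.toLp_add hf1 hf2]
    exact MemLp.toLp_congr _ _
      (.of_forall fun y => congrFun (Set.indicator_self_add_compl S (𝓕⁻ h)).symm y)
  set V2 : Lp (α := ℝ) ℂ 2 volume := 𝓕 (hf2.toLp _) with hV2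
  have hV2n : ∫⁻ s, ‖V2 s‖ₑ ^ 2 = ∫⁻ y in Sᶜ, ‖𝓕⁻ h y‖ₑ ^ 2 := by
    rw [← eLpNorm_two_sq, hV2, eLpNorm_coe_fourier, eLpNorm_congr_ae hf2.coeFn_toLp,
      eLpNorm_indicator_eq_eLpNorm_restrict hS.compl, eLpNorm_two_sq]
  -- The part on `S` is integrable and has a classical transform, needed for duality; the other part
  -- is transformed only in `L²`.
  have hdec : h =ᵐ[volume] fun s => 𝓕 f1 s + V2 s := by
    have h1 := fourier_toLp_fourierInv hh hΦ
    rw [hsum, FourierTransform.fourier_add] at h1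
    filter_upwards [h1, Lp.coeFn_add (𝓕 (hf1.toLp f1)) (𝓕 (hf2.toLp f2)),
      fourier_Lp_ae_eq hf1i hf1.coeFn_toLp] with s h1 h2 h3
    rw [← h1, h2, Pi.add_apply, h3]
  have hkx : ∀ x, AEStronglyMeasurable (k x) (volume.restrict (Icc (-R) R)) := fun x =>
    (hk.comp measurable_prodMk_left).aestronglyMeasurable
  have hV2i : IntegrableOn (fun s => V2 s) (Icc (-R) R) :=
    ((Lp.memLp V2).restrict _).integrable one_le_two
  set H : ℝ → ℂ := (Icc (-R) R).indicator fun s => V2 s with hH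
  have hHi : Integrable H := (integrable_indicator_iff measurableSet_Icc).2 hV2i
  have hH2 : MemLp H 2 := (Lp.memLp V2).indicator measurableSet_Icc
  have hcut : ∀ x, ∫ s, k x s * H s = ∫ s in Icc (-R) R, k x s * V2 s := fun x => by
    rw [← integral_indicator measurableSet_Icc]
    congr 1 with s
    by_cases hs : s ∈ Icc (-R) R <;> simp [hH, hs]
  refine ⟨fun x => ‖∫ s, k x s * H s‖ₑ, ?_, ?_, (hL2 H hHi hH2).trans ?_⟩
  · filter_upwards [ae_restrict_mem measurableSet_Ioi] with x hx
    have hx : 0 < x := hx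
    have hbd : ∀ᵐ s ∂volume.restrict (Icc (-R) R), ‖k x s‖ ≤ 1 := .of_forall fun s => hk1 x s hx
    have hki : IntegrableOn (k x) (Icc (-R) R) :=
      Measure.integrableOn_of_bounded (by simp)
        (hk.comp measurable_prodMk_left).aestronglyMeasurable hbd
    have hsplit : ∫ s in Icc (-R) R, k x s * h s =
        (∫ s in Icc (-R) R, k x s * 𝓕 f1 s) + ∫ s, k x s * H s := by
      rw [hcut, ← integral_add]
      · refine setIntegral_congr_ae measurableSet_Icc ?_
        filter_upwards [hdec] with s hs _
        rw [hs]; ring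
      · exact (((continuous_fourier hf1i).integrableOn_Icc).bdd_mul (hkx x) hbd)
      · exact hV2i.bdd_mul (hkx x) hbd
    rw [hsplit]
    refine (enorm_add_le _ _).trans (add_le_add_left ?_ _)
    have hki' := (integrable_indicator_iff measurableSet_Icc).2 hki
    -- Duality needs an integrable kernel, hence the truncation to `[-R, R]`. The transformed kernel
    -- is then the oscillatory integral bounded by `A`.
    have hdual : ∫ s in Icc (-R) R, k x s * 𝓕 f1 s =
        ∫ y, 𝓕 ((Icc (-R) R).indicator (k x)) y * f1 y := by
      rw [integral_fourier_mul hki' hf1i, ← integral_indicator measurableSet_Icc]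
      congr 1 with s
      by_cases hs : s ∈ Icc (-R) R <;> simp [hs]
    have hker : ∀ y, ‖𝓕 ((Icc (-R) R).indicator (k x)) y‖ ≤ A := fun y => by
      rw [Real.fourier_real_eq_integral_exp_smul]
      refine le_of_eq_of_le ?_ (hosc x R (2 * Real.pi * y) hx)
      congr 1
      rw [← integral_indicator measurableSet_Icc]
      congr 1 with s
      by_cases hs : s ∈ Icc (-R) R
      · simp only [indicator_of_mem hs, smul_eq_mul]
        rw [mul_comm]
        congr 2
        push_cast; ring
      · simp [hs]
    rw [hdual]
    refine (enorm_integral_le_lintegral_enorm _).trans ?_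
    rw [← lintegral_const_mul' _ _ ENNReal.ofReal_ne_top, ← lintegral_indicator hS]
    refine lintegral_mono fun y => ?_
    by_cases hy : y ∈ S
    · simp only [f1, indicator_of_mem hy, enorm_mul]
      gcongr
      rw [← ofReal_norm]
      exact ENNReal.ofReal_le_ofReal (hker y)
    · simp [f1, hy]
  · have := aestronglyMeasurable_integral_kernel hk hHi.1 univ (volume.restrict (Ioi 0))
    simpa only [setIntegral_univ] using this.enorm
  · rw [← hV2n]
    gcongr with s
    by_cases hs : s ∈ Icc (-R) R <;> simp [hH, hs]

/-- Taking the `r`-th root turns the exponents `r - 2` and `r - 1` into `1 - 2/r` and `1/p`. The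
numerical factors are at most `32` and `2` for every `r`, so the constant does not depend on `r`. -/
theorem rpow_interpolation_constant_le {A N p r : ℝ} (hA : 0 < A) (hN : 0 < N) (hr : 2 < r)
    (hpr : p + r = p * r) :
    (32 * (2 * A * N) ^ (r - 2) * N) ^ (1 / r) ≤ 64 * A ^ (1 - 2 * r⁻¹) * N ^ (1 / p) := by
  have hr0 : 0 < r := by linarith
  have hp0 : p ≠ 0 := fun h => by simp [h] at hpr; linarith
  have hN1 : (2 * A * N) ^ (r - 2) * N = 2 ^ (r - 2) * A ^ (r - 2) * N ^ (r - 1) := by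
    rw [Real.mul_rpow (by positivity) hN.le, Real.mul_rpow (by positivity) hA.le, mul_assoc,
      ← Real.rpow_add_one hN.ne', show r - 2 + 1 = r - 1 by ring]
  have e1 : (r - 2) * (1 / r) = 1 - 2 * r⁻¹ := by field_simp
  have e2 : (r - 1) * (1 / r) = 1 / p := by field_simp; linarith
  have hexp : 0 ≤ 1 - 2 * r⁻¹ ∧ 1 - 2 * r⁻¹ ≤ 1 := by
    have : r⁻¹ ≤ 2⁻¹ := inv_anti₀ two_pos hr.le
    have : 0 < r⁻¹ := by positivity
    constructor <;> linarith
  rw [mul_assoc, hN1, Real.mul_rpow (by norm_num) (by positivity),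
    Real.mul_rpow (by positivity) (by positivity), Real.mul_rpow (by positivity) (by positivity),
    ← Real.rpow_mul two_pos.le, ← Real.rpow_mul hA.le, ← Real.rpow_mul hN.le, e1, e2]
  have h32 : (32 : ℝ) ^ (1 / r) ≤ 32 := by
    calc (32 : ℝ) ^ (1 / r) ≤ 32 ^ (1 : ℝ) :=
          Real.rpow_le_rpow_of_exponent_le (by norm_num) (by rw [div_le_one hr0]; linarith)
      _ = 32 := Real.rpow_one _
  have h2 : (2 : ℝ) ^ (1 - 2 * r⁻¹) ≤ 2 := by
    calc (2 : ℝ) ^ (1 - 2 * r⁻¹) ≤ 2 ^ (1 : ℝ) :=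
          Real.rpow_le_rpow_of_exponent_le (by norm_num) hexp.2
      _ = 2 := Real.rpow_one _
  calc _ ≤ 32 * (2 * A ^ (1 - 2 * r⁻¹) * N ^ (1 / p)) := by gcongr
    _ = _ := by ring

/-- The abstract dispersive estimate: an operator `h ↦ ∫ k(x, s) h(s) ds` with bounded kernel, an
oscillatory integral bound `A` and a uniform `L²` bound satisfies the interpolated estimates
in terms of the inverse Fourier transform of `h`. -/
theorem eLpNorm_integral_kernel_le (hk : Measurable (Function.uncurry k))
    (hk1 : ∀ x s, 0 < x → ‖k x s‖ ≤ 1) (hA : 0 < A)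
    (hosc : ∀ x R y : ℝ, 0 < x → ‖∫ s in Icc (-R) R, k x s * Complex.exp (-(Complex.I * s * y))‖ ≤ A)
    (hL2 : ∀ f, Integrable f → MemLp f 2 →
      ∫⁻ x in Ioi (0 : ℝ), ‖∫ s, k x s * f s‖ₑ ^ 2 ≤ 8 * ∫⁻ s, ‖f s‖ₑ ^ 2)
    (hh : Integrable h) {r r' : ℝ≥0∞} (hr : 2 ≤ r) (hrr : ENNReal.HolderConjugate r r') :
    eLpNorm (fun x => ∫ s, k x s * h s) r (volume.restrict (Ioi 0)) ≤
      64 * ENNReal.ofReal (A ^ (1 - 2 * (r⁻¹).toReal)) * eLpNorm (𝓕⁻ h) r' volume := by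
  have := hrr
  have hr' : 1 ≤ r' := ENNReal.HolderConjugate.one_le r' r
  have hr'2 : r' ≤ 2 := by
    rw [← ENNReal.inv_le_inv, ← ENNReal.HolderConjugate.one_sub_inv r r', ← ENNReal.one_sub_inv_two]
    gcongr
  by_cases htop : eLpNorm (𝓕⁻ h) r' volume = ∞
  · rw [htop, ENNReal.mul_top]
    · exact le_top
    · have : 0 < A ^ (1 - 2 * (r⁻¹).toReal) := by positivity
      simpa using this
  have hΦp : MemLp (𝓕⁻ h) r' :=
    ⟨(continuous_fourierInv hh).aestronglyMeasurable, lt_top_iff_ne_top.2 htop⟩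
  have hΦ : MemLp (𝓕⁻ h) 2 := memLp_two_of_bounded (norm_fourierInv_le (h := h)) hΦp hr' hr'2
  set Wn : ℕ → ℝ → ℂ := fun n x => ∫ s in Icc (-(n : ℝ)) n, k x s * h s with hWn
  have hWm : ∀ n, AEStronglyMeasurable (Wn n) (volume.restrict (Ioi 0)) := fun n =>
    aestronglyMeasurable_integral_kernel hk hh.1 _ _
  have hlim : ∀ᵐ x ∂volume.restrict (Ioi (0 : ℝ)),
      Filter.Tendsto (fun n => Wn n x) Filter.atTop (nhds (∫ s, k x s * h s)) := by
    filter_upwards [ae_restrict_mem measurableSet_Ioi] with x hx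
    have hx : 0 < x := hx
    have hi : Integrable fun s => k x s * h s :=
      hh.bdd_mul (hk.comp measurable_prodMk_left).aestronglyMeasurable (.of_forall fun s => hk1 x s hx)
    exact (aecover_Icc (Filter.tendsto_neg_atTop_atBot.comp tendsto_natCast_atTop_atTop)
      tendsto_natCast_atTop_atTop).integral_tendsto_of_countably_generated hi
  -- The bounds are uniform in the window, so Fatou's lemma passes them to the pointwise limit.
  suffices hbound : ∀ n, eLpNorm (Wn n) r (volume.restrict (Ioi 0)) ≤
      64 * ENNReal.ofReal (A ^ (1 - 2 * (r⁻¹).toReal)) * eLpNorm (𝓕⁻ h) r' volume by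
    refine (Lp.eLpNorm_lim_le_liminf_eLpNorm hWm _ hlim).trans ?_
    exact Filter.liminf_le_of_frequently_le' (.of_forall hbound)
  intro n
  have hsplit := fun (S : Set ℝ) (hS : MeasurableSet S) =>
    exists_splitting hk hk1 hA hosc hL2 hh hΦ n hS
  -- where `Φ` does not contribute to the `L²` part, the remainder vanishes
  have hzero : ∀ u : ℝ → ℝ≥0∞, AEMeasurable u (volume.restrict (Ioi 0)) →
      ∫⁻ x in Ioi (0 : ℝ), u x ^ 2 ≤ 0 → ∀ᵐ x ∂volume.restrict (Ioi (0 : ℝ)), u x = 0 := by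
    intro u hum hu
    filter_upwards [(lintegral_eq_zero_iff' (hum.pow_const 2)).1 (nonpos_iff_eq_zero.1 hu)] with x hx
    simpa using hx
  rcases eq_or_ne r ∞ with rfl | hrtop
  · obtain rfl : r' = 1 := (ENNReal.HolderConjugate.eq_top_iff_eq_one ∞ r').1 rfl
    -- At `r = ∞` all of `Φ` goes into the `L¹` part; at `r = 2` below, all of it goes into the `L²`
    -- part.
    obtain ⟨u, hu1, hum, hu2⟩ := hsplit univ .univ
    have hu0 := hzero u hum (by simpa using hu2)
    rw [eLpNorm_exponent_top, eLpNorm_one_eq_lintegral_enorm]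
    refine essSup_le_of_ae_le _ ?_
    filter_upwards [hu1, hu0] with x hx1 hx2
    rw [hx2, add_zero, setLIntegral_univ] at hx1
    refine hx1.trans ?_
    simp only [ENNReal.inv_top, ENNReal.toReal_zero, mul_zero, sub_zero, Real.rpow_one, mul_assoc]
    exact le_mul_of_one_le_left zero_le (by norm_num)
  rcases hr.eq_or_lt with rfl | hr2
  · obtain rfl : r' = 2 := ENNReal.HolderConjugate.unique 2 r' 2
    obtain ⟨u, hu1, hum, hu2⟩ := hsplit ∅ .empty
    have h1 : eLpNorm (Wn n) 2 (volume.restrict (Ioi 0)) ^ 2 ≤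
        (64 * eLpNorm (𝓕⁻ h) 2 volume) ^ 2 := by
      rw [eLpNorm_two_sq, mul_pow, eLpNorm_two_sq]
      calc _ ≤ ∫⁻ x in Ioi (0 : ℝ), u x ^ 2 := by
            refine lintegral_mono_ae ?_
            filter_upwards [hu1] with x hx
            gcongr
            simpa using hx
        _ ≤ 8 * ∫⁻ y, ‖𝓕⁻ h y‖ₑ ^ 2 := by simpa using hu2
        _ ≤ _ := by gcongr; norm_num
    have h2 := (ENNReal.pow_le_pow_left_iff two_ne_zero).1 h1
    simpa using h2
  -- The interpolation divides by `K = 2AN`, so `N = 0` is treated apart.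
  rcases eq_or_ne (eLpNorm (𝓕⁻ h) r' volume) 0 with h0 | h0
  · obtain ⟨u, hu1, hum, hu2⟩ := hsplit ∅ .empty
    have hΦ0 := (eLpNorm_eq_zero_iff hΦp.1 (zero_lt_one.trans_le hr').ne').1 h0
    have hu0 := hzero u hum (hu2.trans (by
      rw [← eLpNorm_two_sq, compl_empty, Measure.restrict_univ, eLpNorm_congr_ae hΦ0]; simp))
    have hW0 : Wn n =ᵐ[volume.restrict (Ioi 0)] 0 := by
      filter_upwards [hu1, hu0] with x hx1 hx2
      rw [hx2] at hx1
      simpa using hx1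
    rw [eLpNorm_congr_ae hW0]
    simp
  · have hr'0 : r' ≠ 0 := (zero_lt_one.trans_le hr').ne'
    have hr't : r' ≠ ∞ := (hr'2.trans_lt ENNReal.ofNat_lt_top).ne
    have hr0 : r ≠ 0 := (two_pos.trans hr2).ne'
    set ρ := r.toReal with hρ
    set p := r'.toReal with hp
    have hp0 : 0 < p := ENNReal.toReal_pos hr'0 hr't
    have hρ2 : 2 < ρ := by
      have := (ENNReal.toReal_lt_toReal ENNReal.ofNat_ne_top hrtop).2 hr2
      simpa using this
    have hpρ : p + ρ = p * ρ := by
      have h1 := congrArg ENNReal.toReal (ENNReal.HolderConjugate.inv_add_inv_eq_one r r')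
      rw [ENNReal.toReal_add (by simpa using hr0) (by simpa using hr'0), ENNReal.toReal_inv,
        ENNReal.toReal_inv, ENNReal.toReal_one, ← hρ, ← hp] at h1
      have : ρ ≠ 0 := by positivity
      field_simp at h1
      linarith
    have hnorm : ∫⁻ y, ‖𝓕⁻ h y‖ₑ ^ p = eLpNorm (𝓕⁻ h) r' volume ^ p := by
      rw [eLpNorm_eq_lintegral_rpow_enorm_toReal hr'0 hr't, ← ENNReal.rpow_mul, ← hp,
        one_div_mul_cancel hp0.ne', ENNReal.rpow_one]
    set Λ := (eLpNorm (𝓕⁻ h) r' volume).toReal with hΛ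
    have hΛ0 : 0 < Λ := ENNReal.toReal_pos h0 htop
    have hΛe : eLpNorm (𝓕⁻ h) r' volume = ENNReal.ofReal Λ := (ENNReal.ofReal_toReal htop).symm
    have hN0 : 0 < Λ ^ p := by positivity
    rw [hΛe, ENNReal.ofReal_rpow_of_pos hΛ0] at hnorm
    have hmain := lintegral_rpow_le_of_splitting (μ := volume) (ν := volume.restrict (Ioi 0))
      (f := fun y => ‖𝓕⁻ h y‖₊) (g := fun x => ‖(hWm n).mk _ x‖₊) (B := 8)
      (continuous_fourierInv hh).nnnorm.measurable
      (hWm n).stronglyMeasurable_mk.measurable.nnnorm hA hN0 hρ2 hpρ hnorm (by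
        intro S hS
        obtain ⟨u, hu1, -, hu2⟩ := hsplit S hS
        refine ⟨u, ?_, hu2⟩
        filter_upwards [hu1, (hWm n).ae_eq_mk] with x hx1 hx2
        rw [← hx2]
        exact hx1)
    have hmk : ∫⁻ x in Ioi (0 : ℝ), ‖Wn n x‖ₑ ^ ρ ≤
        ENNReal.ofReal (32 * (2 * A * Λ ^ p) ^ (ρ - 2) * Λ ^ p) := by
      calc _ = ∫⁻ x in Ioi (0 : ℝ), ((‖(hWm n).mk _ x‖₊ : ℝ≥0) : ℝ≥0∞) ^ ρ := by
            refine lintegral_congr_ae ?_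
            filter_upwards [(hWm n).ae_eq_mk] with x hx
            rw [hx]; rfl
        _ ≤ _ := hmain
        _ = _ := by
            rw [ENNReal.ofReal_mul (by positivity), ENNReal.ofReal_mul (by positivity),
              ENNReal.ofReal_ofNat]
            norm_num
    rw [eLpNorm_eq_lintegral_rpow_enorm_toReal hr0 hrtop, ← hρ, ENNReal.toReal_inv, ← hρ, hΛe]
    calc _ ≤ ENNReal.ofReal (32 * (2 * A * Λ ^ p) ^ (ρ - 2) * Λ ^ p) ^ (1 / ρ) := by gcongr
      _ = ENNReal.ofReal ((32 * (2 * A * Λ ^ p) ^ (ρ - 2) * Λ ^ p) ^ (1 / ρ)) :=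
          ENNReal.ofReal_rpow_of_pos (by positivity)
      _ ≤ ENNReal.ofReal (64 * A ^ (1 - 2 * ρ⁻¹) * (Λ ^ p) ^ (1 / p)) :=
          ENNReal.ofReal_le_ofReal (rpow_interpolation_constant_le hA hN0 hρ2 hpρ)
      _ = _ := by
          rw [← Real.rpow_mul hΛ0.le, mul_one_div_cancel hp0.ne', Real.rpow_one,
            ENNReal.ofReal_mul (by positivity), ENNReal.ofReal_mul (by norm_num),
            ENNReal.ofReal_ofNat]

end Dispersive

/-! ### The exponential kernels on the five paths. -/

section Paths

open Complex (I)

/-- The closed parameter interval of each path. -/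
def pathSupport : Fin 5 → Set ℝ
  | 0 => Ici 0
  | 1 => Icc 0 (1 / Real.sqrt 2)
  | 2 => Ici (1 / Real.sqrt 2)
  | 3 => Ici (1 / Real.sqrt 2)
  | 4 => Iic (-(1 / Real.sqrt 2))

/-- The exponential `e^{ikx - w(k)t}` along a path, extended by zero. -/
def pathKernel (t : ℝ) (i : Fin 5) (x s : ℝ) : ℂ :=
  (pathSupport i).indicator (fun s => Complex.exp (I * path i s * x - w (path i s) * t)) s

theorem measurableSet_pathSupport (i : Fin 5) : MeasurableSet (pathSupport i) := by
  fin_cases i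
  exacts [measurableSet_Ici, measurableSet_Icc, measurableSet_Ici, measurableSet_Ici,
    measurableSet_Iic]

theorem continuous_path (i : Fin 5) : Continuous (path i) := by
  fin_cases i <;> simp only [path] <;> fun_prop

theorem measurable_pathKernel (t : ℝ) (i : Fin 5) :
    Measurable (Function.uncurry (pathKernel t i)) := by
  have h := continuous_path i
  refine Measurable.indicator (f := fun q : ℝ × ℝ =>
    Complex.exp (I * path i q.2 * q.1 - w (path i q.2) * t))
    (s := {q | q.2 ∈ pathSupport i}) ?_ (measurable_snd (measurableSet_pathSupport i))
  unfold w
  fun_prop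

theorem inv_sqrt_two_pos : 0 < 1 / Real.sqrt 2 := by positivity

theorem inv_sqrt_two_sq : (1 / Real.sqrt 2) ^ 2 = 1 / 2 := by
  rw [div_pow, Real.sq_sqrt (by norm_num)]; norm_num

theorem half_le_sq {s : ℝ} (hs : 1 / Real.sqrt 2 ≤ s) : 1 / 2 ≤ s ^ 2 := by
  rw [← inv_sqrt_two_sq]; gcongr

theorem inv_sqrt_two_le_one : 1 / Real.sqrt 2 ≤ 1 := by
  nlinarith [inv_sqrt_two_pos, inv_sqrt_two_sq]

theorem w_imaginary (s : ℝ) : w (I * s) = -(I * ((s ^ 4 + s ^ 2 : ℝ) : ℂ)) := by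
  have h4 : I ^ 4 = 1 := Complex.I_pow_four
  unfold w
  push_cast
  rw [mul_pow, mul_pow, h4, Complex.I_sq]
  ring

theorem w_real (s : ℝ) : w s = -(I * ((s ^ 4 - s ^ 2 : ℝ) : ℂ)) := by
  unfold w
  push_cast
  ring

/-- On the hyperbola `k² - 1/2 = 2iσm` is purely imaginary, with `m = √(s² - 1/2)`, so `k⁴ - k² =
(k² - 1/2)² - 1/4` is real. The choices `σ = ±s` cover both arcs. -/
theorem w_hyperbola {s σ : ℝ} (hs : 1 / Real.sqrt 2 ≤ s) (hσ : σ ^ 2 = s ^ 2) :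
    w (σ + I * (Real.sqrt (s ^ 2 - 1 / 2) : ℝ)) =
      I * ((4 * s ^ 4 - 2 * s ^ 2 + 1 / 4 : ℝ) : ℂ) := by
  have hm : (Real.sqrt (s ^ 2 - 1 / 2) : ℂ) ^ 2 = (s : ℂ) ^ 2 - 1 / 2 := by
    have := Real.sq_sqrt (show 0 ≤ s ^ 2 - 1 / 2 by linarith [half_le_sq hs])
    rw [← Complex.ofReal_pow, this]
    push_cast
    ring
  have hσ' : (σ : ℂ) ^ 2 = (s : ℂ) ^ 2 := by exact_mod_cast congrArg (fun z : ℝ => (z : ℂ)) hσ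
  set m : ℂ := (Real.sqrt (s ^ 2 - 1 / 2) : ℂ)
  have hk2 : (σ + I * m) ^ 2 = 1 / 2 + 2 * σ * I * m := by
    linear_combination m ^ 2 * Complex.I_sq - hm + hσ'
  have hk4 : (σ + I * m) ^ 4 - (σ + I * m) ^ 2 = -(4 * s ^ 4 - 2 * s ^ 2 + 1 / 4 : ℂ) := by
    rw [show (σ + I * m) ^ 4 = ((σ + I * m) ^ 2) ^ 2 by ring, hk2]
    linear_combination 4 * σ ^ 2 * m ^ 2 * Complex.I_sq - 4 * σ ^ 2 * hm -
      4 * (s ^ 2 - 1 / 2) * hσ'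
  unfold w
  rw [hk4]
  push_cast
  ring

theorem w_path_two {s : ℝ} (hs : 1 / Real.sqrt 2 ≤ s) :
    w (path 2 s) = I * ((4 * s ^ 4 - 2 * s ^ 2 + 1 / 4 : ℝ) : ℂ) := w_hyperbola hs rfl

theorem w_path_three {s : ℝ} (hs : 1 / Real.sqrt 2 ≤ s) :
    w (path 3 s) = I * ((4 * s ^ 4 - 2 * s ^ 2 + 1 / 4 : ℝ) : ℂ) := by
  have := w_hyperbola (σ := -s) hs (neg_sq s)
  simpa [path] using this

theorem w_path_re {i : Fin 5} {s : ℝ} (hs : s ∈ pathSupport i) : (w (path i s)).re = 0 := by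
  fin_cases i
  · simp [path, w_imaginary, -Complex.ofReal_add]
  · simp [path, w_real, -Complex.ofReal_sub]
  · change (w (path 2 s)).re = 0
    rw [w_path_two hs, Complex.re_mul_ofReal, Complex.I_re, zero_mul]
  · change (w (path 3 s)).re = 0
    rw [w_path_three hs, Complex.re_mul_ofReal, Complex.I_re, zero_mul]
  · simp [path, w_real, -Complex.ofReal_sub]

theorem norm_cexp_path {i : Fin 5} {s : ℝ} (hs : s ∈ pathSupport i) (t x : ℝ) :
    ‖Complex.exp (I * path i s * x - w (path i s) * t)‖ = Real.exp (-(x * (path i s).im)) := by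
  rw [Complex.norm_exp]
  congr 1
  simp [w_path_re hs]
  ring

theorem path_im_nonneg {i : Fin 5} {s : ℝ} (hs : s ∈ pathSupport i) : 0 ≤ (path i s).im := by
  fin_cases i
  · have : 0 ≤ s := hs
    simpa [path] using this
  · simp [path]
  · simp [path, Real.sqrt_nonneg]
  · simp [path, Real.sqrt_nonneg]
  · simp [path]

theorem norm_pathKernel_le {t x : ℝ} (i : Fin 5) (s : ℝ) (hx : 0 < x) : ‖pathKernel t i x s‖ ≤ 1 := by
  unfold pathKernel
  by_cases hs : s ∈ pathSupport i
  · rw [indicator_of_mem hs, norm_cexp_path hs, Real.exp_le_one_iff]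
    have := mul_nonneg hx.le (path_im_nonneg hs)
    linarith
  · simp [hs]

/-! ### The `t^{-1/4}` bound on each path. -/

section Oscillation

theorem norm_setIntegral_indicator_Ici_le {f g : ℝ → ℂ} {a M : ℝ} (ha : 0 ≤ a) (hM : 0 ≤ M)
    (h : ∀ R, a ≤ R → ‖∫ s in a..R, f s * g s‖ ≤ M) (R : ℝ) :
    ‖∫ s in Icc (-R) R, (Ici a).indicator f s * g s‖ ≤ M := by
  have h1 : ∀ s, (Ici a).indicator f s * g s = (Ici a).indicator (fun s => f s * g s) s :=
    fun s => by by_cases hs : s ∈ Ici a <;> simp [hs]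
  simp only [h1]
  rw [setIntegral_indicator measurableSet_Ici]
  rcases le_or_gt a R with haR | haR
  · have : Icc (-R) R ∩ Ici a = Icc a R := by
      ext s; simp only [mem_inter_iff, mem_Icc, mem_Ici]
      exact ⟨fun hs => ⟨hs.2, hs.1.2⟩, fun hs => ⟨⟨by linarith [hs.1], hs.2⟩, hs.1⟩⟩
    rw [this, integral_Icc_eq_integral_Ioc, ← intervalIntegral.integral_of_le haR]
    exact h R haR
  · have : Icc (-R) R ∩ Ici a = ∅ := by
      ext s; simp only [mem_inter_iff, mem_Icc, mem_Ici, mem_empty_iff_false, iff_false]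
      rintro ⟨hs, hs'⟩; linarith [hs.2]
    rw [this]; simpa using hM

theorem norm_setIntegral_indicator_Iic_le {f g : ℝ → ℂ} {a M : ℝ} (ha : 0 ≤ a) (hM : 0 ≤ M)
    (h : ∀ R, a ≤ R → ‖∫ s in a..R, f (-s) * g (-s)‖ ≤ M) (R : ℝ) :
    ‖∫ s in Icc (-R) R, (Iic (-a)).indicator f s * g s‖ ≤ M := by
  have h1 := norm_setIntegral_indicator_Ici_le (f := fun s => f (-s)) (g := fun s => g (-s))
    ha hM h R
  convert h1 using 2
  rw [← integral_indicator measurableSet_Icc, ← integral_indicator measurableSet_Icc,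
    ← integral_neg_eq_self]
  congr 1 with s
  by_cases hs : s ∈ Icc (-R) R
  · have hs' : -s ∈ Icc (-R) R := ⟨by linarith [hs.2], by linarith [hs.1]⟩
    rw [indicator_of_mem hs, indicator_of_mem hs']
    by_cases ha : a ≤ s
    · rw [indicator_of_mem (by simpa using ha), indicator_of_mem (by exact ha)]
    · rw [indicator_of_notMem (by simpa using ha), indicator_of_notMem (by exact ha)]
  · have hs' : -s ∉ Icc (-R) R := fun h => hs ⟨by linarith [h.2], by linarith [h.1]⟩
    rw [indicator_of_notMem hs, indicator_of_notMem hs']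

theorem hasDerivAt_quartic (t α β γ η s : ℝ) :
    HasDerivAt (fun s : ℝ => t * (α * s ^ 4 + β * s ^ 2 + γ) + η * s)
      (t * (4 * α * s ^ 3 + 2 * β * s) + η) s := by
  have h := ((((hasDerivAt_pow 4 s).const_mul α).add ((hasDerivAt_pow 2 s).const_mul β)).add_const
    γ).const_mul t |>.add ((hasDerivAt_id s).const_mul η)
  refine h.congr_deriv ?_
  push_cast
  ring

theorem hasDerivAt_quartic_deriv (t α β η s : ℝ) :
    HasDerivAt (fun s : ℝ => t * (4 * α * s ^ 3 + 2 * β * s) + η)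
      (t * (12 * α * s ^ 2 + 2 * β)) s := by
  have h := ((((hasDerivAt_pow 3 s).const_mul (4 * α)).add
    ((hasDerivAt_id s).const_mul (2 * β))).const_mul t).add_const η
  refine h.congr_deriv ?_
  push_cast
  ring

variable {A : ℝ → ℝ} {t a b : ℝ}

theorem norm_integral_quartic_le (α β γ η : ℝ) (ht : 0 < t) (ha : 0 ≤ a) (hab : a ≤ b)
    (hαβ : ∀ s, a ≤ s → s ^ 2 ≤ 12 * α * s ^ 2 + 2 * β) (hA : Measurable A)
    (hanti : AntitoneOn A (Icc a b)) (hA0 : ∀ s ∈ Icc a b, 0 ≤ A s) (hA1 : ∀ s ∈ Icc a b, A s ≤ 1) :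
    ‖∫ s in a..b, (A s : ℂ) * Complex.exp
      (I * ((t * (α * s ^ 4 + β * s ^ 2 + γ) + η * s : ℝ) : ℂ))‖ ≤ 9 * t ^ (-(1 / 4) : ℝ) :=
  norm_integral_antitone_mul_quartic_phase_le (hasDerivAt_quartic t α β γ η)
    (hasDerivAt_quartic_deriv t α β η) (by fun_prop) ht ha hab
    (fun s hs => mul_le_mul_of_nonneg_left (hαβ s hs.1) ht.le) hA hanti hA0 hA1

theorem norm_integral_neg_quartic_le (α β γ η : ℝ) (ht : 0 < t) (ha : 0 ≤ a) (hab : a ≤ b)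
    (hαβ : ∀ s, a ≤ s → s ^ 2 ≤ 12 * α * s ^ 2 + 2 * β) (hA : Measurable A)
    (hanti : AntitoneOn A (Icc a b)) (hA0 : ∀ s ∈ Icc a b, 0 ≤ A s) (hA1 : ∀ s ∈ Icc a b, A s ≤ 1) :
    ‖∫ s in a..b, (A s : ℂ) * Complex.exp
      (-(I * ((t * (α * s ^ 4 + β * s ^ 2 + γ) + η * s : ℝ) : ℂ)))‖ ≤ 9 * t ^ (-(1 / 4) : ℝ) :=
  norm_integral_antitone_mul_neg_quartic_phase_le (hasDerivAt_quartic t α β γ η)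
    (hasDerivAt_quartic_deriv t α β η) (by fun_prop) ht ha hab
    (fun s hs => mul_le_mul_of_nonneg_left (hαβ s hs.1) ht.le) hA hanti hA0 hA1

/-- The curvature condition is `s² ≤ 48 s² - 4`, true once `s² ≥ 1/2`. The linear coefficient `η`
absorbs the frequency `y` together with the oscillation `e^{±isx}` coming from `Re k`; only the
decreasing damping is left as amplitude. -/
theorem norm_integral_hyperbola_le {x : ℝ} (hx : 0 ≤ x) (ht : 0 < t) (η : ℝ)
    (hb : 1 / Real.sqrt 2 ≤ b) :
    ‖∫ s in (1 / Real.sqrt 2)..b, ((Real.exp (-(x * Real.sqrt (s ^ 2 - 1 / 2))) : ℝ) : ℂ) *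
      Complex.exp (-(I * ((t * (4 * s ^ 4 + (-2) * s ^ 2 + 1 / 4) + η * s : ℝ) : ℂ)))‖ ≤
        9 * t ^ (-(1 / 4) : ℝ) := by
  refine norm_integral_neg_quartic_le 4 (-2) (1 / 4) η ht inv_sqrt_two_pos.le hb
    (fun s hs => by linarith [half_le_sq hs]) (by fun_prop) ?_ (fun s _ => (Real.exp_pos _).le) ?_
  · intro s hs s' hs' hss
    have : 0 ≤ s := inv_sqrt_two_pos.le.trans hs.1
    simp only
    gcongr
  · intro s _
    rw [Real.exp_le_one_iff]
    have := mul_nonneg hx (Real.sqrt_nonneg (s ^ 2 - 1 / 2))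
    linarith

theorem norm_setIntegral_pathKernel_mul_cexp_le (i : Fin 5) {x : ℝ} (hx : 0 < x) (ht : 0 < t)
    (ht1 : t ≤ 1) (R y : ℝ) :
    ‖∫ s in Icc (-R) R, pathKernel t i x s * Complex.exp (-(I * s * y))‖ ≤
      9 * t ^ (-(1 / 4) : ℝ) := by
  have hM : 0 ≤ 9 * t ^ (-(1 / 4) : ℝ) := by positivity
  have hII := Complex.I_mul_I
  fin_cases i
  · refine norm_setIntegral_indicator_Ici_le le_rfl hM (fun b hb => ?_) R
    refine le_of_eq_of_le (congrArg _ (intervalIntegral.integral_congr fun s _ => ?_))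
      (norm_integral_quartic_le (A := fun s => Real.exp (-(x * s))) 1 1 0 (-y) ht le_rfl hb
        (fun s _ => by nlinarith [sq_nonneg s]) (by fun_prop) ?_ (fun s _ => (Real.exp_pos _).le) ?_)
    · simp only [path, w_imaginary]
      rw [← Complex.exp_add, Complex.ofReal_exp, ← Complex.exp_add]
      congr 1
      push_cast
      linear_combination (s * x : ℂ) * hII
    · intro s _ s' _ hss
      simp only
      gcongr
    · intro s hs
      rw [Real.exp_le_one_iff]
      have := mul_nonneg hx.le hs.1
      linarith
  -- Here the second derivative `t (12 s² - 2)` of the phase changes sign inside the interval. The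
  -- trivial bound by the length, at most `1 ≤ t^{-1/4}`, replaces oscillation.
  · change ‖∫ s in Icc (-R) R, pathKernel t 1 x s * Complex.exp (-(I * s * y))‖ ≤ _
    have h1 : ∀ s, pathKernel t 1 x s * Complex.exp (-(I * s * y)) =
        (Icc 0 (1 / Real.sqrt 2)).indicator
          (fun s => pathKernel t 1 x s * Complex.exp (-(I * s * y))) s := by
      intro s
      by_cases hs : s ∈ Icc 0 (1 / Real.sqrt 2)
      · rw [indicator_of_mem hs]
      · have hs' : s ∉ pathSupport 1 := hs
        rw [indicator_of_notMem hs, pathKernel, indicator_of_notMem hs', zero_mul]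
    have hvol : volume.real (Icc (-R) R ∩ Icc 0 (1 / Real.sqrt 2)) ≤ 1 := by
      refine (measureReal_mono inter_subset_right (by simp)).trans ?_
      rw [Real.volume_real_Icc_of_le inv_sqrt_two_pos.le, sub_zero]
      exact inv_sqrt_two_le_one
    rw [setIntegral_congr_fun measurableSet_Icc fun s _ => h1 s,
      setIntegral_indicator measurableSet_Icc]
    refine (norm_setIntegral_le_of_norm_le_const (C := 1)
      ((measure_mono inter_subset_right).trans_lt (by simp)) fun s _ => ?_).trans ?_
    · rw [norm_mul, show -(I * s * y) = I * ((-(s * y) : ℝ) : ℂ) by push_cast; ring,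
        norm_cexp_I_mul, mul_one]
      exact norm_pathKernel_le 1 s hx
    · have : 1 ≤ t ^ (-(1 / 4) : ℝ) := Real.one_le_rpow_of_pos_of_le_one_of_nonpos ht ht1 (by norm_num)
      linarith
  · refine norm_setIntegral_indicator_Ici_le inv_sqrt_two_pos.le hM (fun b hb => ?_) R
    refine le_of_eq_of_le (congrArg _ (intervalIntegral.integral_congr fun s hs => ?_))
      (norm_integral_hyperbola_le hx.le ht (y - x) hb)
    rw [uIcc_of_le hb] at hs
    change Complex.exp (I * path 2 s * x - w (path 2 s) * t) * _ = _
    rw [w_path_two hs.1]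
    simp only [path]
    rw [← Complex.exp_add, Complex.ofReal_exp, ← Complex.exp_add]
    congr 1
    push_cast
    linear_combination (Real.sqrt (s ^ 2 - 1 / 2) * x : ℂ) * hII
  · refine norm_setIntegral_indicator_Ici_le inv_sqrt_two_pos.le hM (fun b hb => ?_) R
    refine le_of_eq_of_le (congrArg _ (intervalIntegral.integral_congr fun s hs => ?_))
      (norm_integral_hyperbola_le hx.le ht (y + x) hb)
    rw [uIcc_of_le hb] at hs
    change Complex.exp (I * path 3 s * x - w (path 3 s) * t) * _ = _
    rw [w_path_three hs.1]
    simp only [path]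
    rw [← Complex.exp_add, Complex.ofReal_exp, ← Complex.exp_add]
    congr 1
    push_cast
    linear_combination (Real.sqrt (s ^ 2 - 1 / 2) * x : ℂ) * hII
  -- After reflection `s² ≥ 1/2`, which keeps the phase `s⁴ - s²` convex: `12 s² - 2 ≥ s²`. There is
  -- no damping on this path, so the amplitude is `1`.
  · refine norm_setIntegral_indicator_Iic_le inv_sqrt_two_pos.le hM (fun b hb => ?_) R
    refine le_of_eq_of_le (congrArg _ (intervalIntegral.integral_congr fun s hs => ?_))
      (norm_integral_quartic_le (A := fun _ => 1) 1 (-1) 0 (y - x) ht inv_sqrt_two_pos.le hb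
        (fun s hs => by nlinarith [half_le_sq hs]) (by fun_prop) (fun _ _ _ _ _ => le_rfl)
        (fun _ _ => zero_le_one) (fun _ _ => le_rfl))
    simp only [path, w_real]
    rw [← Complex.exp_add, Complex.ofReal_one, one_mul]
    congr 1
    push_cast
    ring

end Oscillation

/-- The uniform `L²` bound for the five kernels. -/
theorem lintegral_pathKernel_sq_le (t : ℝ) (i : Fin 5) {f : ℝ → ℂ} (hf : Integrable f)
    (hf2 : MemLp f 2) :
    ∫⁻ x in Ioi (0 : ℝ), ‖∫ s, pathKernel t i x s * f s‖ₑ ^ 2 ≤ 8 * ∫⁻ s, ‖f s‖ₑ ^ 2 := by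
  have hreal : ∀ j : Fin 5, (∀ s, path j s = (s : ℂ)) →
      ∫⁻ x in Ioi (0 : ℝ), ‖∫ s, pathKernel t j x s * f s‖ₑ ^ 2 ≤ 8 * ∫⁻ s, ‖f s‖ₑ ^ 2 := by
    intro j hj
    have h := lintegral_sq_fourier_symbol_le
      (b := (pathSupport j).indicator fun s => Complex.exp (-(w s * t))) ?_ ?_ hf hf2
    · have key : ∀ x s, pathKernel t j x s * f s = Complex.exp (I * s * x) *
          (pathSupport j).indicator (fun s => Complex.exp (-(w s * t))) s * f s := by
        intro x s
        unfold pathKernel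
        by_cases hs : s ∈ pathSupport j
        · rw [indicator_of_mem hs, indicator_of_mem hs, hj, ← Complex.exp_add, sub_eq_add_neg]
        · rw [indicator_of_notMem hs, indicator_of_notMem hs, mul_zero]
      simp only [key]
      exact h
    · refine Measurable.indicator ?_ (measurableSet_pathSupport j)
      unfold w
      fun_prop
    · intro s
      by_cases hs : s ∈ pathSupport j
      · rw [indicator_of_mem hs, w_real, show -(-(I * ((s ^ 4 - s ^ 2 : ℝ) : ℂ)) * t) =
          I * (((s ^ 4 - s ^ 2) * t : ℝ) : ℂ) by push_cast; ring, norm_cexp_I_mul]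
      · simp [hs]
  have hlap : ∀ (j : Fin 5) (c : ℝ), pathSupport j = Ici c →
      (∀ s, c ≤ s → s - c ≤ (path j s).im) →
      ∫⁻ x in Ioi (0 : ℝ), ‖∫ s, pathKernel t j x s * f s‖ₑ ^ 2 ≤ 8 * ∫⁻ s, ‖f s‖ₑ ^ 2 := by
    intro j c hj him
    refine lintegral_sq_le_of_norm_le_exp (c := c) (fun x s hs => ?_) (fun x s hx hs => ?_) hf.1
    · rw [pathKernel, indicator_of_notMem]
      rw [hj]; simpa using hs
    · have hs' : s ∈ pathSupport j := by rw [hj]; exact hs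
      rw [pathKernel, indicator_of_mem hs', norm_cexp_path hs']
      have := him s hs
      gcongr
  -- With `c = 1/√2` this is `(s - c)² ≤ s² - c²`; it gives the damping on the arcs the rate of a
  -- Laplace kernel started at `c`.
  have hsqrt : ∀ s, 1 / Real.sqrt 2 ≤ s → s - 1 / Real.sqrt 2 ≤ Real.sqrt (s ^ 2 - 1 / 2) := by
    intro s hs
    refine Real.le_sqrt_of_sq_le ?_
    nlinarith [inv_sqrt_two_pos, inv_sqrt_two_sq]
  fin_cases i
  · exact hlap 0 0 rfl fun s _ => by simp [path]
  · exact hreal 1 fun s => rfl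
  · exact hlap 2 _ rfl fun s hs => by simpa [path] using hsqrt s hs
  · exact hlap 3 _ rfl fun s hs => by simpa [path] using hsqrt s hs
  · exact hreal 4 fun s => rfl

end Paths

/-! ### Assembling the five estimates. -/

section Estimate

open Complex (I)
open FourierTransform

/-- The constant velocity of the first path, which is not part of `PsiHat`. -/
def pathFactor : Fin 5 → ℂ
  | 0 => I
  | _ => 1

theorem norm_pathFactor (i : Fin 5) : ‖pathFactor i‖ = 1 := by
  fin_cases i <;> simp [pathFactor]

theorem norm_orientation (i : Fin 5) : ‖orientation i‖ = 1 := by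
  fin_cases i <;> simp [orientation]

variable {ν : ℂ → ℂ} {T : ℝ} {g₀ g₁ : ℝ → ℂ}

theorem pathFactor_mul_PsiHat (i : Fin 5) (s : ℝ) :
    pathFactor i * PsiHat ν T g₀ g₁ i s =
      (pathSupport i).indicator (fun s => G ν g₀ g₁ (path i s) T * velocity i s) s := by
  fin_cases i
  · change I * (Ici (0 : ℝ)).indicator _ s = (Ici (0 : ℝ)).indicator _ s
    by_cases hs : s ∈ Ici (0 : ℝ)
    · simp [hs, path, velocity, mul_comm]
    · simp [hs]
  · change (1 : ℂ) * (Icc (0 : ℝ) (1 / Real.sqrt 2)).indicator (fun s => G ν g₀ g₁ s T) s =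
      (Icc (0 : ℝ) (1 / Real.sqrt 2)).indicator (fun s => G ν g₀ g₁ s T * 1) s
    simp only [one_mul, mul_one]
  · exact one_mul _
  · exact one_mul _
  · change (1 : ℂ) * (Iic (-(1 / Real.sqrt 2))).indicator (fun s => G ν g₀ g₁ s T) s =
      (Iic (-(1 / Real.sqrt 2))).indicator (fun s => G ν g₀ g₁ s T * 1) s
    simp only [one_mul, mul_one]

theorem param_ae_eq_pathSupport (i : Fin 5) : param i =ᵐ[volume] pathSupport i := by
  fin_cases i
  · exact Filter.EventuallyEq.rfl
  · exact Ioo_ae_eq_Icc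
  · exact Filter.EventuallyEq.rfl
  · exact Filter.EventuallyEq.rfl
  · exact Filter.EventuallyEq.rfl

theorem integrable_PsiHat (hG : AbsIntegrableAlongBoundary ν T g₀ g₁) (i : Fin 5) :
    Integrable (PsiHat ν T g₀ g₁ i) := by
  have h1 := (integrable_indicator_iff (measurableSet_pathSupport i)).2
    ((hG i).congr_set_ae (param_ae_eq_pathSupport i).symm)
  have h2 := h1.const_mul (pathFactor i)⁻¹
  refine h2.congr (.of_forall fun s => ?_)
  have h0 : pathFactor i ≠ 0 := norm_ne_zero_iff.1 (by simp [norm_pathFactor])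
  simp only [← pathFactor_mul_PsiHat]
  rw [inv_mul_cancel_left₀ h0]

theorem Wb_eq_sum (x t : ℝ) : Wb ν T g₀ g₁ x t =
    ∑ i : Fin 5, (orientation i * (-(1 / (2 * Real.pi)) * pathFactor i)) *
      ∫ s, pathKernel t i x s * PsiHat ν T g₀ g₁ i s := by
  unfold Wb boundaryIntegral
  refine Finset.sum_congr rfl fun i _ => ?_
  rw [mul_assoc (orientation i)]
  congr 1
  rw [setIntegral_congr_set (param_ae_eq_pathSupport i), ← integral_const_mul,
    ← integral_indicator (measurableSet_pathSupport i)]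
  refine integral_congr_ae (.of_forall fun s => ?_)
  dsimp only
  have h := pathFactor_mul_PsiHat (ν := ν) (T := T) (g₀ := g₀) (g₁ := g₁) i s
  by_cases hs : s ∈ pathSupport i
  · rw [indicator_of_mem hs] at h ⊢
    simp only [pathKernel, indicator_of_mem hs, E]
    linear_combination (1 / (2 * Real.pi) * Complex.exp (I * path i s * x - w (path i s) * t)) * h
  · simp [pathKernel, hs]

theorem fourierInv_eq_invFourier (h : ℝ → ℂ) (y : ℝ) :
    𝓕⁻ h y = 2 * Real.pi * invFourier h (2 * Real.pi * y) := by
  have hpi : (Real.pi : ℂ) ≠ 0 := by exact_mod_cast Real.pi_ne_zero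
  rw [invFourier, ← mul_assoc, mul_one_div_cancel (by simp), one_mul,
    Real.fourierInv_eq_fourier_neg, Real.fourier_real_eq_integral_exp_smul]
  congr 1 with s
  rw [smul_eq_mul]
  congr 2
  push_cast
  ring

theorem continuous_invFourier {h : ℝ → ℂ} (hh : Integrable h) : Continuous (invFourier h) := by
  have hpi : (Real.pi : ℂ) ≠ 0 := by exact_mod_cast Real.pi_ne_zero
  have : invFourier h = fun y => (2 * Real.pi : ℂ)⁻¹ * 𝓕⁻ h ((2 * Real.pi)⁻¹ * y) := by
    funext y
    rw [fourierInv_eq_invFourier, mul_inv_cancel_left₀ Real.two_pi_pos.ne',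
      inv_mul_cancel_left₀ (by simp)]
  rw [this]
  have := continuous_fourierInv hh
  fun_prop

/-- The dilation by `2π` multiplies the norm by a power of `2π` that is at most one and is dropped.
The factor `2π` that stays is later cancelled by the `1/(2π)` in `E`. -/
theorem eLpNorm_fourierInv_le {h : ℝ → ℂ} (hh : Integrable h) (p : ℝ≥0∞) :
    eLpNorm (𝓕⁻ h) p volume ≤ ENNReal.ofReal (2 * Real.pi) * eLpNorm (invFourier h) p volume := by
  have hm := (continuous_invFourier hh).aestronglyMeasurable (μ := volume.map (2 * Real.pi * ·))
  have h1 : 𝓕⁻ h = (2 * Real.pi : ℂ) • (invFourier h ∘ (2 * Real.pi * ·)) := by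
    funext y
    exact fourierInv_eq_invFourier h y
  have h2 : ‖(2 * Real.pi : ℂ)‖ₑ = ENNReal.ofReal (2 * Real.pi) := by
    rw [← ofReal_norm, ← Complex.ofReal_ofNat, ← Complex.ofReal_mul, Complex.norm_real,
      Real.norm_of_nonneg Real.two_pi_pos.le]
  rw [h1, eLpNorm_const_smul, h2, ← eLpNorm_map_measure hm (by fun_prop)]
  gcongr
  rw [Real.map_volume_mul_left Real.two_pi_pos.ne']
  have : ENNReal.ofReal |(2 * Real.pi)⁻¹| ≤ 1 := by
    rw [abs_of_pos (by positivity), ENNReal.ofReal_le_one]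
    exact inv_le_one_of_one_le₀ (by linarith [Real.pi_gt_three])
  calc ENNReal.ofReal |(2 * Real.pi)⁻¹| • (volume : Measure ℝ) ≤ (1 : ℝ≥0∞) • volume := by gcongr
    _ = volume := one_smul _ _

theorem aestronglyMeasurable_Wb (hG : AbsIntegrableAlongBoundary ν T g₀ g₁) (t : ℝ) :
    AEStronglyMeasurable (fun x => Wb ν T g₀ g₁ x t) (volume.restrict (Ioi 0)) := by
  simp only [Wb_eq_sum]
  refine Finset.aestronglyMeasurable_fun_sum _ fun i _ => AEStronglyMeasurable.const_mul ?_ _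
  have := aestronglyMeasurable_integral_kernel (measurable_pathKernel t i)
    (integrable_PsiHat hG i).1 univ (volume.restrict (Ioi 0))
  simpa only [setIntegral_univ] using this

/-- The dispersive estimate along a single path. -/
theorem eLpNorm_path_le (hG : AbsIntegrableAlongBoundary ν T g₀ g₁) (i : Fin 5) {r r' : ℝ≥0∞}
    (hr : 2 ≤ r) (hrr : ENNReal.HolderConjugate r r') {t : ℝ} (ht : 0 < t) (ht1 : t ≤ 1) :
    eLpNorm (fun x => (orientation i * (-(1 / (2 * Real.pi)) * pathFactor i)) *
      ∫ s, pathKernel t i x s * PsiHat ν T g₀ g₁ i s) r (volume.restrict (Ioi 0)) ≤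
      576 * ENNReal.ofReal (t ^ (-(1 / 4 - (r⁻¹).toReal / 2))) *
        eLpNorm (Psi ν T g₀ g₁ i) r' volume := by
  have hh := integrable_PsiHat hG i
  have hmain := eLpNorm_integral_kernel_le (A := 9 * t ^ (-(1 / 4) : ℝ)) (measurable_pathKernel t i)
    (fun x s hx => norm_pathKernel_le i s hx) (by positivity)
    (fun x R y hx => norm_setIntegral_pathKernel_mul_cexp_le i hx ht ht1 R y)
    (fun f hf hf2 => lintegral_pathKernel_sq_le t i hf hf2) hh hr hrr
  have hc : ‖orientation i * (-(1 / (2 * Real.pi)) * pathFactor i)‖ₑ =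
      ENNReal.ofReal (2 * Real.pi)⁻¹ := by
    rw [← ofReal_norm, norm_mul, norm_mul, norm_orientation, norm_pathFactor, one_mul, mul_one,
      norm_neg, one_div, norm_inv, ← Complex.ofReal_ofNat, ← Complex.ofReal_mul, Complex.norm_real,
      Real.norm_of_nonneg Real.two_pi_pos.le]
  set e : ℝ := 1 - 2 * (r⁻¹).toReal with he
  have he1 : e ≤ 1 := by have := ENNReal.toReal_nonneg (a := r⁻¹); linarith
  -- The interpolation exponent `1 - 2/r` turns `-1/4` into the claimed power of `t`; `9 ^ e ≤ 9`
  -- removes the dependence on `r`. The final constant is `64 · 9 = 576`.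
  have hpow : (9 * t ^ (-(1 / 4) : ℝ)) ^ e ≤ 9 * t ^ (-(1 / 4 - (r⁻¹).toReal / 2)) := by
    rw [Real.mul_rpow (by norm_num) (by positivity), ← Real.rpow_mul ht.le]
    have h1 : -(1 / 4) * e = -(1 / 4 - (r⁻¹).toReal / 2) := by rw [he]; ring
    have h2 : (9 : ℝ) ^ e ≤ 9 := by
      calc (9 : ℝ) ^ e ≤ 9 ^ (1 : ℝ) := Real.rpow_le_rpow_of_exponent_le (by norm_num) he1
        _ = 9 := Real.rpow_one _
    rw [h1]
    gcongr
  change eLpNorm ((orientation i * (-(1 / (2 * Real.pi)) * pathFactor i)) • fun x =>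
      ∫ s, pathKernel t i x s * PsiHat ν T g₀ g₁ i s) r (volume.restrict (Ioi 0)) ≤ _
  rw [eLpNorm_const_smul, hc]
  calc _ ≤ ENNReal.ofReal (2 * Real.pi)⁻¹ *
        (64 * ENNReal.ofReal (9 * t ^ (-(1 / 4 - (r⁻¹).toReal / 2))) *
          (ENNReal.ofReal (2 * Real.pi) * eLpNorm (Psi ν T g₀ g₁ i) r' volume)) := by
        gcongr
        refine hmain.trans ?_
        gcongr
        exact eLpNorm_fourierInv_le hh r'
    _ = (ENNReal.ofReal (2 * Real.pi)⁻¹ * ENNReal.ofReal (2 * Real.pi)) *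
        ((64 * 9) * ENNReal.ofReal (t ^ (-(1 / 4 - (r⁻¹).toReal / 2))) *
          eLpNorm (Psi ν T g₀ g₁ i) r' volume) := by
        rw [ENNReal.ofReal_mul (by norm_num : (0:ℝ) ≤ 9), ENNReal.ofReal_ofNat]
        ring
    _ = _ := by
        rw [← ENNReal.ofReal_mul (by positivity), inv_mul_cancel₀ Real.two_pi_pos.ne',
          ENNReal.ofReal_one, one_mul]
        norm_num

theorem eLpNorm_Wb_le (hG : AbsIntegrableAlongBoundary ν T g₀ g₁) {r r' : ℝ≥0∞}
    (hr : 2 ≤ r) (hrr : ENNReal.HolderConjugate r r') {t : ℝ} (ht : 0 < t) (ht1 : t ≤ 1) :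
    eLpNorm (fun x => Wb ν T g₀ g₁ x t) r (volume.restrict (Ioi 0)) ≤
      576 * ENNReal.ofReal (t ^ (-(1 / 4 - (r⁻¹).toReal / 2))) *
        ∑ i : Fin 5, eLpNorm (Psi ν T g₀ g₁ i) r' volume := by
  have h1 : (fun x => Wb ν T g₀ g₁ x t) = ∑ i : Fin 5, fun x =>
      (orientation i * (-(1 / (2 * Real.pi)) * pathFactor i)) *
        ∫ s, pathKernel t i x s * PsiHat ν T g₀ g₁ i s := by
    funext x
    rw [Wb_eq_sum, Finset.sum_apply]
  rw [h1, Finset.mul_sum]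
  refine (eLpNorm_sum_le (fun i _ => ?_) (one_le_two.trans hr)).trans
    (Finset.sum_le_sum fun i _ => eLpNorm_path_le hG i hr hrr ht ht1)
  refine AEStronglyMeasurable.const_mul ?_ _
  have := aestronglyMeasurable_integral_kernel (measurable_pathKernel t i)
    (integrable_PsiHat hG i).1 univ (volume.restrict (Ioi 0))
  simpa only [setIntegral_univ] using this

end Estimate

/-! ### Decay of `G` along the boundary for `C²` data. -/

section Decay

variable {ν : ℂ → ℂ} {T : ℝ} {f g g₀ g₁ : ℝ → ℂ}

theorem norm_timeTransform_le (hT : 0 ≤ T) (hf : IntegrableOn f (Ioc 0 T)) {z : ℂ} (hz : z.re = 0) :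
    ‖timeTransform f z T‖ ≤ ∫ s in (0 : ℝ)..T, ‖f s‖ := by
  refine intervalIntegral.norm_integral_le_of_norm_le hT (.of_forall fun s _ => ?_)
    ((intervalIntegrable_iff_integrableOn_Ioc_of_le hT).2 hf.norm)
  rw [norm_mul, Complex.norm_exp]
  simp [hz]

theorem mul_timeTransform (hf : ContDiff ℝ 1 f) (h0 : f 0 = 0) (hT : f T = 0) (z : ℂ) :
    z * timeTransform f z T = -timeTransform (deriv f) z T := by
  have hE : ∀ s : ℝ, HasDerivAt (fun s : ℝ => Complex.exp (z * s)) (z * Complex.exp (z * s)) s := by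
    intro s
    have := ((Complex.ofRealCLM.hasDerivAt (x := s)).const_mul z).cexp
    exact this.congr_deriv (by simp; ring)
  have hd : Continuous (deriv f) := hf.continuous_deriv le_rfl
  have h := intervalIntegral.integral_mul_deriv_eq_deriv_mul (a := 0) (b := T)
    (u := fun s : ℝ => Complex.exp (z * s)) (v := f)
    (fun s _ => hE s) (fun s _ => (hf.differentiable one_ne_zero s).hasDerivAt)
    (by apply Continuous.intervalIntegrable; fun_prop) (hd.intervalIntegrable _ _)
  rw [h0, hT, mul_zero, mul_zero, sub_zero, zero_sub] at h
  unfold timeTransform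
  rw [h, neg_neg, ← intervalIntegral.integral_const_mul]
  simp only [mul_assoc]

/-- Two integrations by parts: the time transform of `C²` data decays quadratically on `iℝ`. -/
theorem exists_timeTransform_decay (hT : 0 < T) (hg : Integrable g) (hs : tsupport g ⊆ Ioo 0 T)
    (hg2 : ContDiff ℝ 2 g) :
    ∃ K, 0 ≤ K ∧ ∀ z : ℂ, z.re = 0 → (1 + ‖z‖) ^ 2 * ‖timeTransform g z T‖ ≤ K := by
  have hd : ContDiff ℝ 1 (deriv g) := by
    have : ContDiff ℝ (1 + 1) g := by rwa [one_add_one_eq_two]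
    exact (contDiff_succ_iff_deriv.1 this).2.2
  have hds : tsupport (deriv g) ⊆ Ioo 0 T := tsupport_deriv_subset.trans hs
  have hvan : ∀ u : ℝ → ℂ, tsupport u ⊆ Ioo 0 T → u 0 = 0 ∧ u T = 0 := fun u hu =>
    ⟨image_eq_zero_of_notMem_tsupport fun h => lt_irrefl _ (hu h).1,
      image_eq_zero_of_notMem_tsupport fun h => lt_irrefl _ (hu h).2⟩
  have hdd : Continuous (deriv (deriv g)) := hd.continuous_deriv le_rfl
  set K0 := ∫ s in (0 : ℝ)..T, ‖g s‖
  set K2 := ∫ s in (0 : ℝ)..T, ‖deriv (deriv g) s‖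
  have hK0 : 0 ≤ K0 := intervalIntegral.integral_nonneg hT.le fun _ _ => norm_nonneg _
  have hK2 : 0 ≤ K2 := intervalIntegral.integral_nonneg hT.le fun _ _ => norm_nonneg _
  -- From `(1 + x)² ≤ 2 + 2x²`: `K0` bounds the transform itself, `K2` bounds `‖z‖²` times it.
  refine ⟨2 * (K0 + K2), by positivity, fun z hz => ?_⟩
  have h0 : ‖timeTransform g z T‖ ≤ K0 := norm_timeTransform_le hT.le hg.integrableOn hz
  have h2 : ‖z‖ ^ 2 * ‖timeTransform g z T‖ ≤ K2 := by
    have h1 := mul_timeTransform (hg2.of_le one_le_two) (hvan g hs).1 (hvan g hs).2 z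
    have h2 := mul_timeTransform hd (hvan _ hds).1 (hvan _ hds).2 z
    have h3 : z ^ 2 * timeTransform g z T = timeTransform (deriv (deriv g)) z T := by
      linear_combination z * h1 - h2
    rw [← norm_pow, ← norm_mul, h3]
    exact norm_timeTransform_le hT.le hdd.integrableOn_Ioc hz
  nlinarith [sq_nonneg (1 - ‖z‖), norm_nonneg (timeTransform g z T),
    mul_nonneg (sq_nonneg (1 - ‖z‖)) (norm_nonneg (timeTransform g z T))]

theorem norm_branch_le (hν : ν ∈ branches) (k : ℂ) : ‖ν k‖ ≤ 1 + ‖k‖ := by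
  have h1 : ‖ν k‖ ^ 2 ≤ 1 + ‖k‖ ^ 2 := by
    rw [← norm_pow, sq_of_mem_branches hν, ← norm_pow k]
    exact (norm_sub_le _ _).trans (by simp)
  nlinarith [norm_nonneg k, norm_nonneg (ν k)]

/-- Only `|w| ≥ |k|⁴ - |k|²` is used; with this lower bound the constant `16` is attained at `|k| =
1`. -/
theorem one_add_norm_pow_four_le (k : ℂ) : (1 + ‖k‖) ^ 4 ≤ 16 * (1 + ‖w k‖) := by
  have h1 : ‖k‖ ^ 4 - ‖k‖ ^ 2 ≤ ‖w k‖ := by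
    rw [w, norm_mul, norm_neg, Complex.norm_I, one_mul, ← norm_pow, ← norm_pow]
    exact norm_sub_norm_le _ _
  nlinarith [sq_nonneg (‖k‖ ^ 2 - 1), sq_nonneg (‖k‖ - 1), sq_nonneg (‖k‖ + 1),
    mul_nonneg (norm_nonneg k) (sq_nonneg (‖k‖ - 1)), norm_nonneg k,
    mul_nonneg (sq_nonneg ‖k‖) (sq_nonneg (‖k‖ - 1))]

theorem abs_le_norm_path {i : Fin 5} (s : ℝ) : |s| ≤ ‖path i s‖ := by
  fin_cases i
  · simp [path]
  · simp [path]
  · have := Complex.abs_re_le_norm (path 2 s)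
    simpa [path] using this
  · have := Complex.abs_re_le_norm (path 3 s)
    simpa [path] using this
  · simp [path]

theorem exists_norm_G_path_le (hν : ν ∈ branches) (hT : 0 < T) (h₀ : Integrable g₀)
    (h₁ : Integrable g₁) (hs₀ : tsupport g₀ ⊆ Ioo 0 T) (hs₁ : tsupport g₁ ⊆ Ioo 0 T)
    (hc₀ : ContDiff ℝ 2 g₀) (hc₁ : ContDiff ℝ 2 g₁) :
    ∃ M, 0 ≤ M ∧ ∀ i, ∀ s ∈ pathSupport i, ‖G ν g₀ g₁ (path i s) T‖ ≤ M * (1 + s ^ 2)⁻¹ := by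
  obtain ⟨K₀, hK₀, hd₀⟩ := exists_timeTransform_decay hT h₀ hs₀ hc₀
  obtain ⟨K₁, hK₁, hd₁⟩ := exists_timeTransform_decay hT h₁ hs₁ hc₁
  -- `1024 = 4 · 16²`: the `4` comes from the prefactor of cubic growth, the `16²` from replacing
  -- `(1 + |w|)²` by `(1 + |k|)⁸`.
  refine ⟨1024 * (K₀ + K₁), by positivity, fun i s hs => ?_⟩
  have hw := w_path_re hs
  have hsk := abs_le_norm_path (i := i) s
  generalize path i s = k at *
  set q := 1 + ‖k‖ with hq
  have hq1 : 1 ≤ q := by linarith [norm_nonneg k]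
  have hq0 : 0 < q := by linarith
  have hν' := norm_branch_le hν k
  have hdec : ∀ {u : ℂ} {K : ℝ}, (1 + ‖w k‖) ^ 2 * ‖u‖ ≤ K → q ^ 8 * ‖u‖ ≤ 256 * K := by
    intro u K hu
    have h4 := one_add_norm_pow_four_le k
    calc q ^ 8 * ‖u‖ = (q ^ 4) ^ 2 * ‖u‖ := by ring
      _ ≤ (16 * (1 + ‖w k‖)) ^ 2 * ‖u‖ := by gcongr
      _ = 256 * ((1 + ‖w k‖) ^ 2 * ‖u‖) := by ring
      _ ≤ 256 * K := by gcongr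
  have e₀ := hdec (hd₀ (w k) hw)
  have e₁ := hdec (hd₁ (w k) hw)
  have hkq : ‖k‖ ≤ q := by linarith
  have hsum : ‖k + ν k‖ ≤ 2 * q := (norm_add_le _ _).trans (by linarith)
  have hG : ‖G ν g₀ g₁ k T‖ ≤
      4 * q ^ 3 * (‖timeTransform g₁ (w k) T‖ + ‖timeTransform g₀ (w k) T‖) := by
    calc _ ≤ 2 * 1 * ‖k‖ * ‖k + ν k‖ * ‖timeTransform g₁ (w k) T‖ +
          2 * ‖k‖ * ‖ν k‖ * ‖k + ν k‖ * ‖timeTransform g₀ (w k) T‖ := by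
          refine (norm_sub_le _ _).trans (le_of_eq ?_)
          simp
      _ ≤ 2 * 1 * q * (2 * q) * ‖timeTransform g₁ (w k) T‖ +
          2 * q * q * (2 * q) * ‖timeTransform g₀ (w k) T‖ := by gcongr
      _ = 4 * q ^ 2 * ‖timeTransform g₁ (w k) T‖ + 4 * q ^ 3 * ‖timeTransform g₀ (w k) T‖ := by ring
      _ ≤ 4 * q ^ 3 * ‖timeTransform g₁ (w k) T‖ + 4 * q ^ 3 * ‖timeTransform g₀ (w k) T‖ := by
          gcongr 4 * ?_ * _ + _
          exact pow_le_pow_right₀ hq1 (by norm_num)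
      _ = _ := by ring
  have hs2 : 1 + s ^ 2 ≤ q ^ 2 := by
    rw [← sq_abs s]; nlinarith [abs_nonneg s, norm_nonneg k]
  -- The available decay is `q^{3-8} = q⁻⁵`; an inverse square is enough for integrability.
  have hq5 : q ^ 2 ≤ q ^ 5 := pow_le_pow_right₀ hq1 (by norm_num)
  rw [← div_eq_mul_inv, le_div_iff₀ (by positivity)]
  calc _ ≤ 4 * q ^ 3 * (‖timeTransform g₁ (w k) T‖ + ‖timeTransform g₀ (w k) T‖) * q ^ 5 := by
        gcongr
        exact hs2.trans hq5
    _ = 4 * (q ^ 8 * ‖timeTransform g₁ (w k) T‖ + q ^ 8 * ‖timeTransform g₀ (w k) T‖) := by ring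
    _ ≤ 4 * (256 * K₁ + 256 * K₀) := by gcongr
    _ = _ := by ring

end Decay

/-! ### Measurability and integrability of `G` along `∂D⁺`. -/

section Measurability

variable {ν : ℂ → ℂ} {T : ℝ} {g g₀ g₁ : ℝ → ℂ}

theorem measurable_toIcoMod_arg (a : ℝ) :
    Measurable fun k : ℂ => toIcoMod Real.two_pi_pos a (Complex.arg (1 - k ^ 2)) := by
  simp only [toIcoMod_eq_add_fract_mul]
  fun_prop

theorem measurable_toIocMod_arg :
    Measurable fun k : ℂ => toIocMod Real.two_pi_pos 0 (Complex.arg (1 - k ^ 2)) := by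
  simp only [toIocMod_eq_sub_fract_mul]
  fun_prop

/-- The rotated branches jump on the left hyperbolic arc, where `arg (1 - k²)` runs from `0` towards
`π/2` and passes `ε`. Hence measurability takes the place of continuity. -/
theorem measurable_of_mem_branches (hν : ν ∈ branches) : Measurable ν := by
  have hs : ∀ θ : ℂ → ℝ, Measurable θ → Measurable fun k : ℂ => sqrtWithArg (1 - k ^ 2) (θ k) := by
    intro θ hθ
    unfold sqrtWithArg
    fun_prop
  rcases hν with ⟨ε, -, -, rfl⟩ | rfl
  · exact hs _ (measurable_toIcoMod_arg ε)
  · exact Measurable.ite (measurableSet_le measurable_const Complex.measurable_re)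
      (hs _ measurable_toIocMod_arg) (hs _ (measurable_toIcoMod_arg 0))

theorem aestronglyMeasurable_timeTransform (hT : 0 ≤ T) (hg : Integrable g) {z : ℝ → ℂ}
    (hz : Measurable z) (μ : Measure ℝ) [SFinite μ] :
    AEStronglyMeasurable (fun s => timeTransform g (z s) T) μ := by
  unfold timeTransform
  simp only [intervalIntegral.integral_of_le hT]
  exact aestronglyMeasurable_integral_kernel (k := fun s u => Complex.exp (z s * u))
    (by simp only [Function.uncurry_def]; fun_prop) hg.1 _ μ

theorem measurable_velocity (i : Fin 5) : Measurable (velocity i) := by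
  fin_cases i <;> simp only [velocity] <;> fun_prop

theorem aestronglyMeasurable_G_path (hν : ν ∈ branches) (hT : 0 ≤ T) (h₀ : Integrable g₀)
    (h₁ : Integrable g₁) (i : Fin 5) (μ : Measure ℝ) [SFinite μ] :
    AEStronglyMeasurable (fun s => G ν g₀ g₁ (path i s) T * velocity i s) μ := by
  have hp := (continuous_path i).measurable
  have hνp : Measurable fun s => ν (path i s) := (measurable_of_mem_branches hν).comp hp
  have hw : Measurable fun s => w (path i s) := by unfold w; fun_prop
  refine AEStronglyMeasurable.mul (.sub (.mul ?_ (aestronglyMeasurable_timeTransform hT h₁ hw μ))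
    (.mul ?_ (aestronglyMeasurable_timeTransform hT h₀ hw μ))) (measurable_velocity i).aestronglyMeasurable
  · exact ((measurable_const.mul hp).mul (hp.add hνp)).aestronglyMeasurable
  · exact (((measurable_const.mul hp).mul hνp).mul (hp.add hνp)).aestronglyMeasurable

/-- The weight is the derivative of the bounded increasing function `arctan √(s² - 1/2)`. This
handles the inverse-square-root singularity at the vertex and the decay at infinity together, and
explains the `1/2` in `1/2 + s²`. -/
theorem integrableOn_hyperbola_weight :
    IntegrableOn (fun s : ℝ => s / Real.sqrt (s ^ 2 - 1 / 2) * (1 / 2 + s ^ 2)⁻¹)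
      (Ici (1 / Real.sqrt 2)) := by
  rw [integrableOn_Ici_iff_integrableOn_Ioi]
  refine integrableOn_Ioi_deriv_of_nonneg (g := fun s => Real.arctan (Real.sqrt (s ^ 2 - 1 / 2)))
    (l := Real.pi / 2) ?_ ?_ ?_ ?_
  · exact Continuous.continuousWithinAt (by fun_prop)
  · intro s hs
    have hs : 1 / Real.sqrt 2 < s := hs
    have hpos : 0 < s ^ 2 - 1 / 2 := by
      have := inv_sqrt_two_pos
      rw [← inv_sqrt_two_sq]; nlinarith
    have h := (((hasDerivAt_pow 2 s).sub_const (1 / 2)).sqrt hpos.ne').arctan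
    refine h.congr_deriv ?_
    rw [Real.sq_sqrt hpos.le]
    have : Real.sqrt (s ^ 2 - 1 / 2) ≠ 0 := (Real.sqrt_pos.2 hpos).ne'
    have h3 : 1 + (s ^ 2 - 1 / 2) = 1 / 2 + s ^ 2 := by ring
    rw [h3]
    push_cast
    field_simp
  · intro s hs
    have : 0 ≤ s := inv_sqrt_two_pos.le.trans (le_of_lt hs)
    positivity
  · refine (Real.tendsto_arctan_atTop.mono_right nhdsWithin_le_nhds).comp ?_
    refine Real.tendsto_sqrt_atTop.comp ?_
    exact Filter.tendsto_atTop_add_const_right _ _ (Filter.tendsto_pow_atTop two_ne_zero)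

theorem absIntegrableAlongBoundary_of_contDiff (hν : ν ∈ branches) (hT : 0 < T)
    (h₀ : Integrable g₀) (h₁ : Integrable g₁) (hs₀ : tsupport g₀ ⊆ Ioo 0 T)
    (hs₁ : tsupport g₁ ⊆ Ioo 0 T) (hc₀ : ContDiff ℝ 2 g₀) (hc₁ : ContDiff ℝ 2 g₁) :
    AbsIntegrableAlongBoundary ν T g₀ g₁ := by
  obtain ⟨M, hM, hG⟩ := exists_norm_G_path_le hν hT h₀ h₁ hs₀ hs₁ hc₀ hc₁
  intro i
  refine IntegrableOn.congr_set_ae ?_ (param_ae_eq_pathSupport i)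
  have hm := aestronglyMeasurable_G_path hν hT.le h₀ h₁ i (volume.restrict (pathSupport i))
  have hflat : IntegrableOn (fun s : ℝ => M * (1 + s ^ 2)⁻¹) (pathSupport i) :=
    (integrable_inv_one_add_sq.const_mul M).integrableOn
  have hunit : (∀ s, ‖velocity i s‖ = 1) →
      IntegrableOn (fun s => G ν g₀ g₁ (path i s) T * velocity i s) (pathSupport i) := by
    intro hv
    refine hflat.mono' hm ?_
    filter_upwards [ae_restrict_mem (measurableSet_pathSupport i)] with s hs
    rw [norm_mul, hv, mul_one]
    exact hG i s hs
  have hhyp : pathSupport i = Ici (1 / Real.sqrt 2) →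
      (∀ s, ‖velocity i s‖ ≤ 1 + |s| / Real.sqrt (s ^ 2 - 1 / 2)) →
      IntegrableOn (fun s => G ν g₀ g₁ (path i s) T * velocity i s) (pathSupport i) := by
    intro hi hv
    have hw := integrableOn_hyperbola_weight.const_mul M
    rw [← hi] at hw
    refine (hflat.add hw).mono' hm ?_
    filter_upwards [ae_restrict_mem (measurableSet_pathSupport i)] with s hs
    have hs0 : 0 ≤ s := by rw [hi] at hs; exact inv_sqrt_two_pos.le.trans hs
    have h1 := hv s
    rw [abs_of_nonneg hs0] at h1
    have h2 : (1 + s ^ 2)⁻¹ ≤ (1 / 2 + s ^ 2)⁻¹ := inv_anti₀ (by positivity) (by linarith)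
    rw [norm_mul]
    calc _ ≤ M * (1 + s ^ 2)⁻¹ * (1 + s / Real.sqrt (s ^ 2 - 1 / 2)) := by
          gcongr
          exact hG i s hs
      _ = M * (1 + s ^ 2)⁻¹ + M * (s / Real.sqrt (s ^ 2 - 1 / 2) * (1 + s ^ 2)⁻¹) := by ring
      _ ≤ M * (1 + s ^ 2)⁻¹ + M * (s / Real.sqrt (s ^ 2 - 1 / 2) * (1 / 2 + s ^ 2)⁻¹) := by gcongr
  have hv2 : ∀ s : ℝ, ‖Complex.I * s / (Real.sqrt (s ^ 2 - 1 / 2) : ℝ)‖ =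
      |s| / Real.sqrt (s ^ 2 - 1 / 2) := fun s => by
    rw [norm_div, norm_mul, Complex.norm_I, one_mul, Complex.norm_real, Complex.norm_real,
      Real.norm_of_nonneg (Real.sqrt_nonneg _), Real.norm_eq_abs]
  fin_cases i
  · exact hunit fun s => by simp [velocity]
  · exact hunit fun s => by simp [velocity]
  · exact hhyp rfl fun s => (norm_add_le _ _).trans (by rw [hv2]; simp)
  · exact hhyp rfl fun s => (norm_add_le _ _).trans (by rw [hv2]; simp)
  · exact hunit fun s => by simp [velocity]

end Measurability

end HalfLine4NLS

end

theorem theorem2p2 :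
    ∃ C : ℝ≥0, ∀ ν ∈ HalfLine4NLS.branches, ∀ (T : ℝ) (g₀ g₁ : ℝ → ℂ), 0 < T →
      Integrable g₀ → Integrable g₁ → tsupport g₀ ⊆ Ioo 0 T → tsupport g₁ ⊆ Ioo 0 T →
      (ContDiff ℝ 2 g₀ → ContDiff ℝ 2 g₁ →
        HalfLine4NLS.AbsIntegrableAlongBoundary ν T g₀ g₁) ∧
      (HalfLine4NLS.AbsIntegrableAlongBoundary ν T g₀ g₁ →
        ∀ r r' : ℝ≥0∞, 2 ≤ r → ENNReal.HolderConjugate r r' → ∀ t : ℝ, 0 < t → t ≤ 1 →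
          AEStronglyMeasurable (fun x => HalfLine4NLS.Wb ν T g₀ g₁ x t)
            (volume.restrict (Ioi 0)) ∧
          eLpNorm (fun x => HalfLine4NLS.Wb ν T g₀ g₁ x t) r (volume.restrict (Ioi 0)) ≤
            C * ENNReal.ofReal (t ^ (-(1 / 4 - (r⁻¹).toReal / 2))) *
              ∑ i : Fin 5, eLpNorm (HalfLine4NLS.Psi ν T g₀ g₁ i) r' volume) :=
  ⟨576, fun _ hν _ _ _ hT h₀ h₁ hs₀ hs₁ =>
    ⟨fun hc₀ hc₁ => HalfLine4NLS.absIntegrableAlongBoundary_of_contDiff hν hT h₀ h₁ hs₀ hs₁ hc₀ hc₁,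
      fun hG _ _ hr hrr t ht ht1 => ⟨HalfLine4NLS.aestronglyMeasurable_Wb hG t,
        HalfLine4NLS.eLpNorm_Wb_le hG hr hrr ht ht1⟩⟩⟩
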